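/- Let $M$ be a smooth (Hausdorff) paracompact manifold of dimension $n\ge 3$. Let $T^\circ M$ be its slit tangent bundle (the tangent bundle with the zero section removed), with projection $\tau:T^\circ M\to M$ and Liouville field $\Delta$ (the generator of the flow $y\mapsto e^t y$). Let $\sigma:STM\to M$ be the sphere bundle, the quotient manifold of $T^\circ M$ by multiplication of vectors by positive scalars; write $[y]\in STM$ for the class of $y\in T^\circ M$. A path geometry on $M$ is a smooth foliation of $STM$ by oriented one-dimensional submanifolds with the second-order property: if $\mathcal S_s$ is the leaf through $s=[y]$, $y\in T_xM$, then $\sigma_*$ maps the positively oriented tangent vectors to $\mathcal S_s$ at $s$ to positive multiples of $y$. It determines a distribution $\mathcal D$ on $T^\circ M$: a vector $v\in T_y(T^\circ M)$ belongs to $\mathcal D_y$ if and only if the projection of $v$ to $STM$ is tangent to $\mathcal S_{[y]}$. A spray is a smooth vector field $\Gamma$ on $T^\circ M$ with $\tau_*\Gamma_{(x,y)}=y$ for all $x\in M$, $0\ne y\in T_xM$, and $[\Delta,\Gamma]=\Gamma$. Two sprays are projectively equivalent if their geodesics (the projections to $M$ of their integral curves) are the same up to orientation-preserving reparametrization; the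 equivalence classes are called projective classes of sprays. Theorem. For every path geometry on $M$ there is a projective class of sprays on $T^\circ M$ such that, for every spray $\Gamma$ of the class and every $y\in T^\circ M$, the space $\mathcal D_y$ is spanned by $\Delta_y$ and $\Gamma_y$. -/

import Mathlib

open Set Topology
open scoped Manifold ContDiff

namespace PathGeom

noncomputable section

abbrev Base (n : ℕ) : Type := EuclideanSpace ℝ (Fin n)

section Direction

variable {n : ℕ}

lemma finrank_perp (y : Base n) (hy : y ≠ 0) :
    Module.finrank ℝ (Submodule.span ℝ {y})ᗮ = Module.finrank ℝ (Base (n - 1)) := by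
  have h1 := Submodule.finrank_add_finrank_orthogonal (𝕜 := ℝ) (Submodule.span ℝ {y})
  rw [finrank_span_singleton hy, finrank_euclideanSpace_fin] at h1
  rw [finrank_euclideanSpace_fin]
  omega

/-- An identification of the hyperplane orthogonal to `y ≠ 0` with `ℝ^(n-1)`. -/
def perpEquiv (y : Base n) (hy : y ≠ 0) : (Submodule.span ℝ {y})ᗮ ≃L[ℝ] Base (n - 1) :=
  ContinuousLinearEquiv.ofFinrankEq (finrank_perp y hy)

/-- Central projection of the open half space `⟪y, v⟫ > 0` onto a hyperplane orthogonal to `y`;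
it is constant on open rays. -/
def dirFun (y : Base n) (hy : y ≠ 0) (v : Base n) : Base (n - 1) :=
  (inner ℝ y v)⁻¹ • perpEquiv y hy ((Submodule.span ℝ {y})ᗮ.orthogonalProjectionOnto v)

/-- A section of `dirFun`: the point of the hyperplane `⟪y, v⟫ = 1` with coordinates `w`. -/
def dirSec (y : Base n) (hy : y ≠ 0) (w : Base (n - 1)) : Base n :=
  (‖y‖ ^ 2)⁻¹ • y + ((perpEquiv y hy).symm w : Base n)

lemma inner_dirSec (y : Base n) (hy : y ≠ 0) (w : Base (n - 1)) :
    inner ℝ y (dirSec y hy w) = 1 := by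
  have h : inner ℝ y (((perpEquiv y hy).symm w : (Submodule.span ℝ {y})ᗮ) : Base n) = 0 :=
    Submodule.mem_orthogonal_singleton_iff_inner_right.1 ((perpEquiv y hy).symm w).2
  have hn : ‖y‖ ^ 2 ≠ 0 := by simpa using hy
  rw [dirSec, inner_add_right, h, inner_smul_right, real_inner_self_eq_norm_sq,
    inv_mul_cancel₀ hn, add_zero]

lemma dirSec_ne_zero (y : Base n) (hy : y ≠ 0) (w : Base (n - 1)) : dirSec y hy w ≠ 0 := by
  intro h
  have := inner_dirSec y hy w
  simp [h] at this

lemma dirFun_dirSec (y : Base n) (hy : y ≠ 0) (w : Base (n - 1)) :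
    dirFun y hy (dirSec y hy w) = w := by
  rw [dirFun, inner_dirSec, inv_one, one_smul, dirSec, map_add, map_smul]
  have h1 : (Submodule.span ℝ {y})ᗮ.orthogonalProjectionOnto y = 0 := by
    rw [Submodule.orthogonalProjectionOnto_eq_zero_iff, Submodule.orthogonal_orthogonal]
    exact Submodule.mem_span_singleton_self y
  rw [h1, Submodule.orthogonalProjectionOnto_mem_subspace_eq_self]
  simp

lemma dirSec_dirFun (y : Base n) (hy : y ≠ 0) (v : Base n) (hv : 0 < inner ℝ y v) :
    dirSec y hy (dirFun y hy v) = (inner ℝ y v)⁻¹ • v := by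
  have h : (((Submodule.span ℝ {y})ᗮ.orthogonalProjectionOnto v : (Submodule.span ℝ {y})ᗮ) :
      Base n) = v - (inner ℝ y v / ‖y‖ ^ 2) • y := by
    rw [Submodule.orthogonalProjectionOnto_orthogonal]
    simp [Submodule.starProjection_singleton]
  rw [dirSec, dirFun, map_smul, ContinuousLinearEquiv.symm_apply_apply, Submodule.coe_smul, h,
    smul_sub, smul_smul, inv_mul_eq_div, div_div_cancel_left' hv.ne']
  abel

lemma dirFun_smul (y : Base n) (hy : y ≠ 0) (v : Base n) {c : ℝ} (hc : 0 < c) :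
    dirFun y hy (c • v) = dirFun y hy v := by
  rw [dirFun, dirFun, map_smul, map_smul, inner_smul_right, smul_smul, mul_inv, mul_comm c⁻¹,
    mul_assoc, inv_mul_cancel₀ hc.ne', mul_one]

lemma contDiffOn_dirFun (y : Base n) (hy : y ≠ 0) :
    ContDiffOn ℝ ∞ (dirFun y hy) {v | 0 < inner ℝ y v} := by
  refine ContDiffOn.smul (ContDiffOn.inv (f := fun v => inner ℝ y v) ?_ fun v hv => ne_of_gt hv) ?_
  · exact (contDiff_const.inner ℝ contDiff_id).contDiffOn
  · exact ((perpEquiv y hy).contDiff.comp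
      ((Submodule.span ℝ {y})ᗮ.orthogonalProjectionOnto).contDiff).contDiffOn

lemma contDiff_dirSec (y : Base n) (hy : y ≠ 0) : ContDiff ℝ ∞ (dirSec y hy) :=
  contDiff_const.add (((Submodule.span ℝ {y})ᗮ.subtypeL.comp
    (perpEquiv y hy).symm.toContinuousLinearMap).contDiff)

end Direction


variable (n : ℕ) (M : Type*) [TopologicalSpace M] [ChartedSpace (Base n) M]
  [IsManifold (𝓡 n) ∞ M]

section Chart

variable {n M}

/-- The preferred chart of the tangent bundle around `p`. -/
abbrev tchart (p : TangentBundle (𝓡 n) M) :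
    OpenPartialHomeomorph (TangentBundle (𝓡 n) M) (ModelProd (Base n) (Base n)) :=
  chartAt (ModelProd (Base n) (Base n)) p

lemma tchart_smul (p : TangentBundle (𝓡 n) M) (x : M) (y : TangentSpace (𝓡 n) x) (c : ℝ) :
    (tchart p ⟨x, c • y⟩).2 = c • (tchart p ⟨x, y⟩).2 :=
  ContinuousLinearMap.map_smul (M₁ := Base n) (M₂ := Base n)
    (fderivWithin ℝ ((chartAt (Base n) p.1).extend (𝓡 n) ∘
      ((chartAt (Base n) x).extend (𝓡 n)).symm) (range (𝓡 n))
      ((chartAt (Base n) x).extend (𝓡 n) x)) c y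

lemma tchart_snd_eq_zero_iff (p q : TangentBundle (𝓡 n) M) (hq : q ∈ (tchart p).source) :
    (tchart p q).2 = 0 ↔ q.2 = 0 := by
  let e := trivializationAt (Base n) (TangentSpace (𝓡 n) : M → Type _) p.1
  have hb : q.1 ∈ e.baseSet := (TangentBundle.mem_chart_source_iff q p).1 hq
  have h1 : (e q).2 = e.continuousLinearEquivAt ℝ q.1 hb q.2 := by simp
  change (e q).2 = 0 ↔ _
  rw [h1]
  exact (e.continuousLinearEquivAt ℝ q.1 hb).map_eq_zero_iff

lemma continuous_smul_tangentBundle (c : ℝ) :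
    Continuous (fun p : TangentBundle (𝓡 n) M => (⟨p.1, c • p.2⟩ : TangentBundle (𝓡 n) M)) := by
  rw [continuous_iff_continuousAt]
  intro p
  rw [FiberBundle.continuousAt_totalSpace]
  refine ⟨(FiberBundle.continuous_proj (Base n) (TangentSpace (𝓡 n) : M → Type _)).continuousAt, ?_⟩
  have h : (fun q : TangentBundle (𝓡 n) M => (tchart p ⟨q.1, c • q.2⟩).2) =
      fun q => c • (tchart p q).2 := funext fun q => tchart_smul p q.1 q.2 c
  have hc : ContinuousAt (fun q => c • (tchart p q).2) p :=
    ((tchart p).continuousAt (mem_chart_source _ p)).snd.const_smul c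
  rw [← h] at hc
  exact hc

end Chart

/-- The slit tangent bundle, as an open subset of the tangent bundle. -/
def slit : TopologicalSpace.Opens (TangentBundle (𝓡 n) M) where
  carrier := {p | p.2 ≠ 0}
  is_open' := by
    rw [isOpen_iff_mem_nhds]
    intro p hp
    have hmem : p ∈ (tchart p).source := mem_chart_source _ p
    have hc : ContinuousAt (fun q => (tchart p q).2) p := ((tchart p).continuousAt hmem).snd
    have hne : (tchart p p).2 ≠ 0 := fun h => hp ((tchart_snd_eq_zero_iff p p hmem).1 h)
    filter_upwards [hc.eventually_ne hne, (tchart p).open_source.mem_nhds hmem] with q hq hs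
    exact fun h => hq ((tchart_snd_eq_zero_iff p q hs).2 h)

/-- The slit tangent bundle `T°M`: the tangent bundle with the zero section removed, with the
manifold structure of an open subset of the tangent bundle. -/
abbrev SlitTangent : Type _ := slit n M

section Slit

variable {n M}

/-- The projection `T°M → M`. -/
def slitProj (p : SlitTangent n M) : M := p.1.1

/-- The nonzero tangent vector `y ∈ T_x M` underlying the point `(x, y)` of `T°M`. -/
def slitVec (p : SlitTangent n M) : TangentSpace (𝓡 n) (slitProj p) := p.1.2

/-- Multiplication of a nonzero tangent vector by a positive scalar. -/
def scale (c : ℝ) (hc : 0 < c) (p : SlitTangent n M) : SlitTangent n M :=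
  ⟨⟨p.1.1, c • p.1.2⟩, smul_ne_zero hc.ne' p.2⟩

lemma scale_scale (a b : ℝ) (ha : 0 < a) (hb : 0 < b) (p : SlitTangent n M) :
    scale a ha (scale b hb p) = scale (a * b) (mul_pos ha hb) p :=
  Subtype.ext (congrArg (Bundle.TotalSpace.mk p.1.1) (smul_smul a b p.1.2))

lemma scale_one (p : SlitTangent n M) : scale 1 one_pos p = p := by
  simp [scale]

lemma scale_congr {a b : ℝ} (h : a = b) (ha : 0 < a) (p : SlitTangent n M) :
    scale a ha p = scale b (h ▸ ha) p := by
  subst h; rfl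

lemma continuous_scale (c : ℝ) (hc : 0 < c) :
    Continuous (scale c hc : SlitTangent n M → SlitTangent n M) :=
  ((continuous_smul_tangentBundle c).comp continuous_subtype_val).subtype_mk _

end Slit

/-- Two nonzero tangent vectors are equivalent if one is a positive multiple of the other. -/
def raySetoid : Setoid (SlitTangent n M) where
  r p q := ∃ (c : ℝ) (hc : 0 < c), q = scale c hc p
  iseqv :=
    { refl := fun p => ⟨1, one_pos, (scale_one p).symm⟩
      symm := by
        rintro p q ⟨c, hc, rfl⟩
        refine ⟨c⁻¹, inv_pos.2 hc, ?_⟩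
        rw [scale_scale, scale_congr (inv_mul_cancel₀ hc.ne'), scale_one]
      trans := by
        rintro p q r ⟨c, hc, rfl⟩ ⟨d, hd, rfl⟩
        exact ⟨d * c, mul_pos hd hc, scale_scale _ _ _ _ _⟩ }

/-- The sphere bundle `STM`: the quotient of `T°M` by positive rescaling of vectors, with the
quotient topology. -/
def SphereBundle : Type _ := Quotient (raySetoid n M)

instance : TopologicalSpace (SphereBundle n M) :=
  inferInstanceAs (TopologicalSpace (Quotient (raySetoid n M)))

section Sphere

variable {n M}

/-- The quotient map `y ↦ [y]` from `T°M` to `STM`. -/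
def ray (p : SlitTangent n M) : SphereBundle n M := Quotient.mk (raySetoid n M) p

/-- The projection `σ : STM → M`. -/
def sphereProj : SphereBundle n M → M :=
  Quotient.lift slitProj (by rintro p q ⟨c, hc, rfl⟩; rfl)

lemma ray_scale (c : ℝ) (hc : 0 < c) (p : SlitTangent n M) : ray (scale c hc p) = ray p :=
  Quotient.sound ((raySetoid n M).symm ⟨c, hc, rfl⟩)

lemma exists_scale_of_ray_eq {p q : SlitTangent n M} (h : ray p = ray q) :
    ∃ (c : ℝ) (hc : 0 < c), q = scale c hc p := Quotient.exact h

lemma isOpenQuotientMap_ray : IsOpenQuotientMap (ray : SlitTangent n M → SphereBundle n M) where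
  surjective := Quotient.mk_surjective
  continuous := continuous_quotient_mk'
  isOpenMap := by
    intro U hU
    have h : ray ⁻¹' (ray '' U) = ⋃ c : {c : ℝ // 0 < c}, scale (M := M) c.1 c.2 ⁻¹' U := by
      ext p
      simp only [mem_preimage, mem_image, mem_iUnion]
      constructor
      · rintro ⟨q, hq, h⟩
        obtain ⟨c, hc, rfl⟩ := exists_scale_of_ray_eq h.symm
        exact ⟨⟨c, hc⟩, hq⟩
      · rintro ⟨c, hc⟩
        exact ⟨_, hc, ray_scale _ _ _⟩
    have h2 : IsOpen (ray ⁻¹' (ray '' U)) := by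
      rw [h]
      exact isOpen_iUnion fun c => hU.preimage (continuous_scale c.1 c.2)
    exact h2

/-- The fibre coordinate of `p` in its own preferred chart. -/
def dirAt (p : SlitTangent n M) : Base n := (tchart p.1 p.1).2

lemma dirAt_ne_zero (p : SlitTangent n M) : dirAt p ≠ 0 := fun h =>
  p.2 ((tchart_snd_eq_zero_iff p.1 p.1 (mem_chart_source _ p.1)).1 h)

/-- The coordinate expression of the chart of `STM` around `[p]`, on `T°M`. -/
def preChart (p q : SlitTangent n M) : Base n × Base (n - 1) :=
  ((tchart p.1 q.1).1, dirFun (dirAt p) (dirAt_ne_zero p) (tchart p.1 q.1).2)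

/-- The domain, in `T°M`, of the chart of `STM` around `[p]`. -/
def preSource (p : SlitTangent n M) : Set (SlitTangent n M) :=
  {q | q.1 ∈ (tchart p.1).source ∧ 0 < inner ℝ (dirAt p) (tchart p.1 q.1).2}

/-- The local section of `T°M → STM` that inverts the chart of `STM` around `[p]`. -/
def preSection (p : SlitTangent n M) (z : Base n × Base (n - 1)) : TangentBundle (𝓡 n) M :=
  (tchart p.1).symm (z.1, dirSec (dirAt p) (dirAt_ne_zero p) z.2)

/-- The coordinate domain of the chart of `STM` around `[p]`. -/
def preTarget (p : SlitTangent n M) : Set (Base n × Base (n - 1)) :=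
  (chartAt (Base n) (slitProj p)).target ×ˢ univ

lemma mem_tchart_target (p : SlitTangent n M) {z : Base n × Base (n - 1)} (hz : z ∈ preTarget p)
    (v : Base n) : ((z.1, v) : ModelProd (Base n) (Base n)) ∈ (tchart p.1).target :=
  (TangentBundle.mem_chart_target_iff _ _).2 hz.1

lemma tchart_preSection (p : SlitTangent n M) {z : Base n × Base (n - 1)} (hz : z ∈ preTarget p) :
    tchart p.1 (preSection p z) = (z.1, dirSec (dirAt p) (dirAt_ne_zero p) z.2) :=
  (tchart p.1).right_inv (mem_tchart_target p hz _)

lemma preSection_mem_source (p : SlitTangent n M) {z : Base n × Base (n - 1)}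
    (hz : z ∈ preTarget p) : preSection p z ∈ (tchart p.1).source :=
  (tchart p.1).map_target (mem_tchart_target p hz _)

lemma preSection_mem_slit (p : SlitTangent n M) {z : Base n × Base (n - 1)}
    (hz : z ∈ preTarget p) : preSection p z ∈ slit n M := by
  intro h
  have h2 := (tchart_snd_eq_zero_iff p.1 _ (preSection_mem_source p hz)).2 h
  rw [tchart_preSection p hz] at h2
  exact dirSec_ne_zero _ _ _ h2

lemma scale_mem_preSource {p q : SlitTangent n M} (hq : q ∈ preSource p) (c : ℝ) (hc : 0 < c) :
    scale c hc q ∈ preSource p := by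
  refine ⟨(TangentBundle.mem_chart_source_iff _ _).2
    ((TangentBundle.mem_chart_source_iff _ _).1 hq.1), ?_⟩
  change 0 < inner ℝ (dirAt p) (tchart p.1 ⟨q.1.1, c • q.1.2⟩).2
  rw [tchart_smul, inner_smul_right]
  exact mul_pos hc hq.2

lemma preChart_scale (p q : SlitTangent n M) (c : ℝ) (hc : 0 < c) :
    preChart p (scale c hc q) = preChart p q := by
  refine Prod.ext rfl ?_
  change dirFun _ _ (tchart p.1 ⟨q.1.1, c • q.1.2⟩).2 = _
  rw [tchart_smul, dirFun_smul _ _ _ hc]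
  rfl

lemma preSection_preChart {p q : SlitTangent n M} (hq : q ∈ preSource p) :
    preSection p (preChart p q) =
      (scale (inner ℝ (dirAt p) (tchart p.1 q.1).2)⁻¹ (inv_pos.2 hq.2) q).1 := by
  have hs := (scale_mem_preSource hq _ (inv_pos.2 hq.2)).1
  rw [preSection, preChart, dirSec_dirFun _ _ _ hq.2]
  refine Eq.trans ?_ ((tchart p.1).left_inv hs)
  congr 1
  refine Prod.ext rfl ?_
  change _ = (tchart p.1 ⟨q.1.1, _ • q.1.2⟩).2
  rw [tchart_smul]

lemma isOpen_preSource (p : SlitTangent n M) : IsOpen (preSource p) := by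
  have h1 : IsOpen ((tchart p.1).source ∩ tchart p.1 ⁻¹' {z | 0 < inner ℝ (dirAt p) z.2}) :=
    (tchart p.1).isOpen_inter_preimage
      (isOpen_lt continuous_const (continuous_const.inner continuous_snd))
  exact h1.preimage continuous_subtype_val

lemma continuousOn_preChart (p : SlitTangent n M) : ContinuousOn (preChart p) (preSource p) := by
  have h1 : ContinuousOn (fun q : SlitTangent n M => tchart p.1 q.1) (preSource p) :=
    (tchart p.1).continuousOn.comp continuous_subtype_val.continuousOn fun q hq => hq.1
  exact h1.fst.prodMk ((contDiffOn_dirFun _ _).continuousOn.comp h1.snd fun q hq => hq.2)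

lemma continuousOn_preSection (p : SlitTangent n M) :
    ContinuousOn (preSection p) (preTarget p) :=
  (tchart p.1).continuousOn_symm.comp
    (continuous_fst.prodMk ((contDiff_dirSec _ _).continuous.comp continuous_snd)).continuousOn
    fun _ hz => mem_tchart_target p hz _

/-- A representative in `T°M` of an oriented direction. -/
def SphereBundle.rep (s : SphereBundle n M) : SlitTangent n M :=
  (isOpenQuotientMap_ray.surjective s).choose

lemma SphereBundle.ray_rep (s : SphereBundle n M) : ray s.rep = s :=
  (isOpenQuotientMap_ray.surjective s).choose_spec

lemma preChart_rep (p q : SlitTangent n M) : preChart p (ray q).rep = preChart p q := by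
  obtain ⟨c, hc, h⟩ := exists_scale_of_ray_eq (SphereBundle.ray_rep (ray q))
  conv_rhs => rw [h]
  rw [preChart_scale]

lemma rep_mem_preSource {p q : SlitTangent n M} (hq : q ∈ preSource p) :
    (ray q).rep ∈ preSource p := by
  obtain ⟨c, hc, h⟩ := exists_scale_of_ray_eq (SphereBundle.ray_rep (ray q)).symm
  rw [h]
  exact scale_mem_preSource hq c hc

open Classical in
/-- The chart of `STM` around `[p]`: the base point is read in the preferred chart of `M`, and the
direction is read by central projection onto a hyperplane. -/
def sphereChart (p : SlitTangent n M) :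
    OpenPartialHomeomorph (SphereBundle n M) (Base n × Base (n - 1)) where
  toFun s := preChart p s.rep
  invFun z := if h : preSection p z ∈ slit n M then ray ⟨preSection p z, h⟩ else ray p
  source := ray '' preSource p
  target := preTarget p
  map_source' := by
    rintro _ ⟨q, hq, rfl⟩
    rw [preChart_rep]
    exact ⟨(tchart p.1).map_source hq.1 |> (TangentBundle.mem_chart_target_iff _ p.1).1, mem_univ _⟩
  map_target' := by
    intro z hz
    rw [dif_pos (preSection_mem_slit p hz)]
    refine ⟨_, ⟨preSection_mem_source p hz, ?_⟩, rfl⟩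
    rw [tchart_preSection p hz, inner_dirSec]
    exact one_pos
  left_inv' := by
    rintro _ ⟨q, hq, rfl⟩
    have h := preSection_preChart hq
    rw [preChart_rep, dif_pos (by rw [h]; exact Subtype.coe_prop _)]
    exact (congrArg ray (Subtype.ext h)).trans (ray_scale _ _ _)
  right_inv' := by
    intro z hz
    rw [dif_pos (preSection_mem_slit p hz), preChart_rep, preChart]
    simp only [tchart_preSection p hz, dirFun_dirSec]
  open_source := isOpenQuotientMap_ray.isOpenMap _ (isOpen_preSource p)
  open_target := (chartAt (Base n) (slitProj p)).open_target.prod isOpen_univ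
  continuousOn_toFun := by
    rintro _ ⟨q, hq, rfl⟩
    refine ContinuousAt.continuousWithinAt ?_
    rw [← isOpenQuotientMap_ray.continuousAt_comp_iff]
    have h : (fun s : SphereBundle n M => preChart p s.rep) ∘ ray = preChart p :=
      funext fun q => preChart_rep p q
    rw [h]
    exact (continuousOn_preChart p).continuousAt ((isOpen_preSource p).mem_nhds hq)
  continuousOn_invFun := by
    rw [continuousOn_iff_continuous_domRestrict]
    have h : Continuous fun z : preTarget p =>
        ray (⟨preSection p z, preSection_mem_slit p z.2⟩ : SlitTangent n M) :=
      isOpenQuotientMap_ray.continuous.comp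
        ((continuousOn_iff_continuous_domRestrict.1 (continuousOn_preSection p)).subtype_mk _)
    refine h.congr fun z => ?_
    rw [domRestrict_apply, dif_pos (preSection_mem_slit p z.2)]

lemma mem_preSource_self (p : SlitTangent n M) : p ∈ preSource p :=
  ⟨mem_chart_source _ p.1, real_inner_self_pos.2 (dirAt_ne_zero p)⟩

instance : ChartedSpace (Base n × Base (n - 1)) (SphereBundle n M) where
  atlas := range sphereChart
  chartAt s := sphereChart s.rep
  mem_chart_source s := ⟨SphereBundle.rep s, mem_preSource_self _, s.ray_rep⟩
  chart_mem_atlas s := mem_range_self _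

/-- Coordinate changes of the tangent bundle are smooth. -/
lemma contDiffOn_tchart_change (p q : TangentBundle (𝓡 n) M) :
    ContDiffOn ℝ ∞ (fun z : Base n × Base n => show Base n × Base n from tchart q ((tchart p).symm z))
      {z : Base n × Base n | z ∈ ((tchart p).symm.trans (tchart q)).source} := by
  have h := (contDiffGroupoid ∞ (𝓡 n).tangent).compatible
    (chart_mem_atlas (ModelProd (Base n) (Base n)) p)
    (chart_mem_atlas (ModelProd (Base n) (Base n)) q)
  have h2 := (mem_groupoid_of_pregroupoid.1 h).1
  simp only [contDiffPregroupoid, ModelWithCorners.tangent] at h2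
  refine ContDiffOn.mono h2 fun z hz => ⟨hz, ?_⟩
  exact ⟨z, rfl⟩

instance : IsManifold 𝓘(ℝ, Base n × Base (n - 1)) ∞ (SphereBundle n M) := by
  refine isManifold_of_contDiffOn _ _ _ ?_
  rintro _ _ ⟨p, rfl⟩ ⟨q, rfl⟩
  have key : ∀ z ∈ ((sphereChart p).symm.trans (sphereChart q)).source,
      z ∈ preTarget p ∧ preSection p z ∈ (tchart q.1).source ∧
        0 < inner ℝ (dirAt q) (tchart q.1 (preSection p z)).2 ∧
        sphereChart q ((sphereChart p).symm z) =
          ((tchart q.1 (preSection p z)).1,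
            dirFun (dirAt q) (dirAt_ne_zero q) (tchart q.1 (preSection p z)).2) := by
    rintro z ⟨hz, hz2⟩
    have hz : z ∈ preTarget p := hz
    have hs : (sphereChart p).symm z = ray ⟨preSection p z, preSection_mem_slit p hz⟩ :=
      dif_pos (preSection_mem_slit p hz)
    have hz2 : (sphereChart p).symm z ∈ ray '' preSource q := hz2
    rw [hs] at hz2
    obtain ⟨r, hr, hrz⟩ := hz2
    obtain ⟨c, hc, h⟩ := exists_scale_of_ray_eq hrz
    have hmem := scale_mem_preSource hr c hc
    rw [← h] at hmem
    refine ⟨hz, hmem.1, hmem.2, ?_⟩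
    rw [hs]
    exact preChart_rep q _
  have hsec : ContDiff ℝ ∞ fun z : Base n × Base (n - 1) =>
      ((z.1, dirSec (dirAt p) (dirAt_ne_zero p) z.2) : Base n × Base n) :=
    contDiff_fst.prodMk ((contDiff_dirSec _ _).comp contDiff_snd)
  have hch : ContDiffOn ℝ ∞ (fun z : Base n × Base (n - 1) =>
      show Base n × Base n from tchart q.1 (preSection p z))
      ((sphereChart p).symm.trans (sphereChart q)).source :=
    (contDiffOn_tchart_change p.1 q.1).comp hsec.contDiffOn fun z hz =>
      ⟨mem_tchart_target p (key z hz).1 _, (key z hz).2.1⟩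
  have hfin : ContDiffOn ℝ ∞ (fun z => sphereChart q ((sphereChart p).symm z))
      ((sphereChart p).symm.trans (sphereChart q)).source :=
    (hch.fst.prodMk ((contDiffOn_dirFun _ (dirAt_ne_zero q)).comp hch.snd
      fun z hz => (key z hz).2.2.1)).congr fun z hz => (key z hz).2.2.2
  exact hfin.mono fun z hz => hz.1

/-- The quotient map `T°M → STM` is smooth. -/
lemma contMDiff_ray :
    ContMDiff (𝓡 n).tangent 𝓘(ℝ, Base n × Base (n - 1)) ∞
      (ray : SlitTangent n M → SphereBundle n M) := by
  intro p
  have h1 : ContMDiffOn (𝓡 n).tangent 𝓘(ℝ, Base n × Base n) ∞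
      (fun q : SlitTangent n M => (extChartAt (𝓡 n).tangent p.1 q.1 : Base n × Base n))
      (preSource p) :=
    (contMDiffOn_extChartAt (I := (𝓡 n).tangent) (x := p.1)).comp
      contMDiff_subtype_val.contMDiffOn fun q hq => hq.1
  have h2 : ContMDiffOn (𝓡 n).tangent 𝓘(ℝ, Base n × Base (n - 1)) ∞ (preChart p) (preSource p) :=
    (contDiff_fst.contMDiff.comp_contMDiffOn h1).prodMk_space
      ((contDiffOn_dirFun _ (dirAt_ne_zero p)).contMDiffOn.comp
        (contDiff_snd.contMDiff.comp_contMDiffOn h1) fun q hq => hq.2)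
  have h3 : ContMDiffOn 𝓘(ℝ, Base n × Base (n - 1)) 𝓘(ℝ, Base n × Base (n - 1)) ∞
      (sphereChart p).symm (sphereChart p).target :=
    contMDiffOn_symm_of_mem_maximalAtlas
      (IsManifold.subset_maximalAtlas (mem_range_self p))
  have h4 : ContMDiffOn (𝓡 n).tangent 𝓘(ℝ, Base n × Base (n - 1)) ∞ ray (preSource p) := by
    refine (h3.comp h2 fun q hq => ?_).congr fun q hq => ?_
    · have := (sphereChart p).map_source (show ray q ∈ (sphereChart p).source from ⟨q, hq, rfl⟩)
      rwa [show sphereChart p (ray q) = preChart p q from preChart_rep p q] at this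
    · have := (sphereChart p).left_inv (show ray q ∈ (sphereChart p).source from ⟨q, hq, rfl⟩)
      rw [show sphereChart p (ray q) = preChart p q from preChart_rep p q] at this
      exact this.symm
  exact h4.contMDiffAt ((isOpen_preSource p).mem_nhds (mem_preSource_self p))

/-- The projection `σ : STM → M` is smooth. -/
lemma contMDiff_sphereProj :
    ContMDiff 𝓘(ℝ, Base n × Base (n - 1)) (𝓡 n) ∞ (sphereProj : SphereBundle n M → M) := by
  intro s
  have h1 : ContMDiffOn 𝓘(ℝ, Base n × Base (n - 1)) 𝓘(ℝ, Base n × Base (n - 1)) ∞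
      (sphereChart s.rep) (sphereChart s.rep).source :=
    contMDiffOn_of_mem_maximalAtlas (IsManifold.subset_maximalAtlas (mem_range_self _))
  have h2 : ContMDiffOn 𝓘(ℝ, Base n × Base (n - 1)) (𝓡 n) ∞
      (fun t => (sphereChart s.rep t).1) (sphereChart s.rep).source :=
    (contDiff_fst.contMDiff).comp_contMDiffOn h1
  have h3 : ContMDiffOn 𝓘(ℝ, Base n × Base (n - 1)) (𝓡 n) ∞ sphereProj
      (sphereChart s.rep).source := by
    refine ((contMDiffOn_chart_symm (x := slitProj s.rep)).comp h2 fun t ht =>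
      ((sphereChart s.rep).map_source ht).1).congr ?_
    rintro _ ⟨q, hq, rfl⟩
    have h := (chartAt (Base n) (slitProj s.rep)).left_inv
      ((TangentBundle.mem_chart_source_iff _ _).1 hq.1)
    have h5 : (sphereChart s.rep (ray q)).1 = chartAt (Base n) (slitProj s.rep) q.1.1 :=
      congrArg Prod.fst (preChart_rep s.rep q)
    exact h.symm.trans (congrArg (chartAt (Base n) (slitProj s.rep)).symm h5.symm)
  exact h3.contMDiffAt ((sphereChart s.rep).open_source.mem_nhds
    ⟨s.rep, mem_preSource_self _, s.ray_rep⟩)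

end Sphere

/-! ### Sprays -/

section Spray

variable {n M}

/-- The Liouville field `Δ` on `T°M`, the generator of the flow `y ↦ exp t • y`. -/
def liouville (p : SlitTangent n M) : TangentSpace (𝓡 n).tangent p :=
  mfderiv 𝓘(ℝ, ℝ) (𝓡 n).tangent (fun t : ℝ => scale (Real.exp t) (Real.exp_pos t) p) 0 (1 : ℝ)

variable (n M)

/-- A spray on `M`: a smooth vector field `Γ` on `T°M` with `τ_* Γ_(x,y) = y` and
`[Δ, Γ] = Γ`. -/
structure Spray where
  /-- The vector field on `T°M`. -/
  field : ∀ p : SlitTangent n M, TangentSpace (𝓡 n).tangent p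
  smooth : ContMDiff (𝓡 n).tangent (𝓡 n).tangent.tangent ∞
    fun p => (⟨p, field p⟩ : TangentBundle (𝓡 n).tangent (SlitTangent n M))
  second_order : ∀ p : SlitTangent n M,
    mfderiv (𝓡 n).tangent (𝓡 n) (slitProj : SlitTangent n M → M) p (field p) = slitVec p
  homogeneous : ∀ p : SlitTangent n M,
    VectorField.mlieBracket (𝓡 n).tangent liouville field p = field p

variable {n M}

/-- `c` is a geodesic of the spray `Γ` on the set `J` of parameters: it is the projection to `M` of
an integral curve of `Γ`. -/
def Spray.IsGeodesicOn (Γ : Spray n M) (c : ℝ → M) (J : Set ℝ) : Prop :=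
  ∃ γ : ℝ → SlitTangent n M, IsMIntegralCurveOn γ Γ.field J ∧ ∀ t ∈ J, slitProj (γ t) = c t

/-- Every geodesic of `Γ`, defined on an open interval, becomes a geodesic of `Γ'` after an
orientation-preserving reparametrization. -/
def Spray.ReparamTo (Γ Γ' : Spray n M) : Prop :=
  ∀ (J : Set ℝ) (c : ℝ → M), IsOpen J → J.OrdConnected → Γ.IsGeodesicOn c J →
    ∃ (J' : Set ℝ) (h : ℝ → ℝ), IsOpen J' ∧ J'.OrdConnected ∧ ContDiffOn ℝ ∞ h J' ∧
      (∀ t ∈ J', 0 < deriv h t) ∧ h '' J' = J ∧ Γ'.IsGeodesicOn (c ∘ h) J'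

lemma Spray.ReparamTo.refl (Γ : Spray n M) : Γ.ReparamTo Γ := fun J _ hJ hJ' hc =>
  ⟨J, id, hJ, hJ', contDiff_id.contDiffOn, by simp, image_id J, hc⟩

lemma Spray.ReparamTo.trans {Γ₁ Γ₂ Γ₃ : Spray n M} (h₁₂ : Γ₁.ReparamTo Γ₂)
    (h₂₃ : Γ₂.ReparamTo Γ₃) : Γ₁.ReparamTo Γ₃ := by
  intro J c hJ hJc hc
  obtain ⟨J', h, hJ', hJc', hh, hd, rfl, hc'⟩ := h₁₂ J c hJ hJc hc
  obtain ⟨J'', k, hJ'', hJc'', hk, hd', rfl, hc''⟩ := h₂₃ J' _ hJ' hJc' hc'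
  refine ⟨J'', h ∘ k, hJ'', hJc'', hh.comp hk (mapsTo_image k J''), fun t ht => ?_,
    image_comp h k J'', hc''⟩
  have hne : (∞ : ℕ∞ω) ≠ 0 := by simp
  have e1 := (hh.differentiableOn hne).differentiableAt (hJ'.mem_nhds (mem_image_of_mem k ht))
  have e2 := (hk.differentiableOn hne).differentiableAt (hJ''.mem_nhds ht)
  rw [deriv_comp t e1 e2]
  exact mul_pos (hd _ (mem_image_of_mem k ht)) (hd' t ht)

variable (n M)

/-- Projective equivalence of sprays: their geodesics are the same up to orientation-preserving
reparametrization. -/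
def projSetoid : Setoid (Spray n M) where
  r Γ Γ' := Γ.ReparamTo Γ' ∧ Γ'.ReparamTo Γ
  iseqv :=
    { refl := fun Γ => ⟨.refl Γ, .refl Γ⟩
      symm := fun h => ⟨h.2, h.1⟩
      trans := fun h h' => ⟨h.1.trans h'.1, h'.2.trans h.2⟩ }

/-- A projective class of sprays on `T°M`. -/
def ProjectiveClass : Type _ := Quotient (projSetoid n M)

instance : Membership (Spray n M) (ProjectiveClass n M) where
  mem C Γ := Quotient.mk (projSetoid n M) Γ = C

end Spray

/-! ### Path geometries -/

section Foliation

/-- A smooth foliation of the manifold `N`, of dimension `k + 1`, by oriented one-dimensional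
submanifolds, given by a foliated atlas. The plaques of a chart `φ` are the curves in its domain on
which the `ℝ^k`-component of `φ` is constant, oriented by the `ℝ`-component of `φ`. Near each point
any two charts have the same oriented plaques, and the leaves are obtained by piecing plaques
together. -/
structure OrientedFoliation (V : Type*) [NormedAddCommGroup V] [NormedSpace ℝ V] (N : Type*)
    [TopologicalSpace N] [ChartedSpace V N] (k : ℕ) where
  /-- The foliated charts. -/
  charts : Set (OpenPartialHomeomorph N (ℝ × Base k))
  cover : ∀ s : N, ∃ φ ∈ charts, s ∈ φ.source
  smooth : ∀ φ ∈ charts, ContMDiffOn 𝓘(ℝ, V) 𝓘(ℝ, ℝ × Base k) ∞ φ φ.source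
  smooth_symm : ∀ φ ∈ charts, ContMDiffOn 𝓘(ℝ, ℝ × Base k) 𝓘(ℝ, V) ∞ φ.symm φ.target
  compatible : ∀ φ ∈ charts, ∀ ψ ∈ charts, ∀ s ∈ φ.source ∩ ψ.source, ∃ W ∈ 𝓝 s,
    W ⊆ φ.source ∩ ψ.source ∧ ∀ a ∈ W, ∀ b ∈ W, (φ a).2 = (φ b).2 →
      (ψ a).2 = (ψ b).2 ∧ ((φ a).1 ≤ (φ b).1 → (ψ a).1 ≤ (ψ b).1)

variable {V : Type*} [NormedAddCommGroup V] [NormedSpace ℝ V] {N : Type*}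
  [TopologicalSpace N] [ChartedSpace V N] {k : ℕ}

/-- The tangent vector `v` at `s` is tangent to the leaf through `s`. -/
def OrientedFoliation.IsTangent (F : OrientedFoliation V N k) (s : N)
    (v : TangentSpace 𝓘(ℝ, V) s) : Prop :=
  ∀ φ ∈ F.charts, s ∈ φ.source → (mfderiv 𝓘(ℝ, V) 𝓘(ℝ, ℝ × Base k) φ s v : ℝ × Base k).2 = 0

/-- The tangent vector `v` at `s` is tangent to the leaf through `s`, nonzero, and positively
oriented. -/
def OrientedFoliation.IsPositive (F : OrientedFoliation V N k) (s : N)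
    (v : TangentSpace 𝓘(ℝ, V) s) : Prop :=
  F.IsTangent s v ∧ ∀ φ ∈ F.charts, s ∈ φ.source →
    0 < (mfderiv 𝓘(ℝ, V) 𝓘(ℝ, ℝ × Base k) φ s v : ℝ × Base k).1

end Foliation

/-- A path geometry on `M`, `dim M = n`: a smooth foliation of the `(2 n - 1)`-dimensional manifold
`STM` by oriented one-dimensional submanifolds with the second-order property: the oriented tangent
line at `[y]` of the leaf through `[y]` projects to the oriented line of `y`. -/
structure PathGeometry extends
    OrientedFoliation (Base n × Base (n - 1)) (SphereBundle n M) (2 * n - 2) where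
  second_order : ∀ (p : SlitTangent n M)
    (v : TangentSpace 𝓘(ℝ, Base n × Base (n - 1)) (ray p)),
    toOrientedFoliation.IsPositive (ray p) v →
      ∃ c : ℝ, 0 < c ∧
        mfderiv 𝓘(ℝ, Base n × Base (n - 1)) (𝓡 n) (sphereProj : SphereBundle n M → M) (ray p) v =
          c • slitVec p

variable {n M}

/-- The distribution `𝒟` on `T°M` determined by a path geometry: `v ∈ 𝒟_y` if the projection of `v`
to `STM` is tangent to the leaf through `[y]`. -/
def PathGeometry.distribution (F : PathGeometry n M) (p : SlitTangent n M) :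
    Submodule ℝ (TangentSpace (𝓡 n).tangent p) where
  carrier := {v | F.IsTangent (ray p)
    (mfderiv (𝓡 n).tangent 𝓘(ℝ, Base n × Base (n - 1)) ray p v)}
  zero_mem' := by
    intro φ _ _
    rw [map_zero, map_zero]
    rfl
  add_mem' := by
    intro v w hv hw φ hφ hs
    rw [map_add, map_add]
    exact (congrArg₂ (· + ·) (hv φ hφ hs) (hw φ hφ hs)).trans (add_zero _)
  smul_mem' := by
    intro c v hv φ hφ hs
    rw [map_smul, map_smul]
    exact (congrArg (c • ·) (hv φ hφ hs)).trans (smul_zero c)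

end

end PathGeom

open PathGeom

/-!
A path geometry and a spray are two ways of recording the same family of oriented curves, and the
proof passes between them through the `2`-dimensional distribution `𝒟` on `T°M`.

*The distribution.* The tangent line of the leaf at `[y]` is generated by a vector that `σ_*` maps
to a positive multiple of `y` (`OrientedFoliation.exists_isPositive`, where the compatibility of
foliated charts makes the tangent line independent of the chart). The kernel of `T°M → STM` on
tangent vectors is the line of `Δ` (`exists_smul_liouville_of_mfderiv_ray_eq_zero`). Hence a vector
of `𝒟_y` is determined by its projection to `M`, a multiple of `y`, up to multiples of `Δ_y`, and
every `v ∈ 𝒟_y` with `τ_* v = y` satisfies `𝒟_y = span {Δ_y, v}`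
(`PathGeometry.distribution_eq_span`).

*Existence of a spray in `𝒟`.* The remaining freedom, a multiple of `Δ`, is fixed by a positive
smooth function `N` on `T°M`, homogeneous of degree two, such as the square of the norm of a
Riemannian metric (`exists_homogeneous_contMDiff_pos`): Euler's identity `Δ N = 2 N` shows that
there is exactly one `Γ_y ∈ 𝒟_y` with `τ_* Γ_y = y` and `Γ_y N = 0`. In coordinates `Γ` is the
solution of an invertible linear system (`constraintMap`) with smooth coefficients, so it is smooth.
The system is invariant under `y ↦ c y`, so `Γ` is homogeneous of degree one, which is
`[Δ, Γ] = Γ` (`lieBracket_coordLiouville`). No gluing of local sprays is needed; the only global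
input is `N`, which exists on a paracompact manifold without any countability assumption.

*Invariance under projective equivalence.* If a geodesic of `Γ` becomes a geodesic of `Γ'` under an
orientation-preserving reparametrization, the two velocity curves differ by positive factors and
hence have the same image in `STM`. Differentiating, the projections of `Γ` and `Γ'` to `STM` are
proportional, so that `Γ` is a section of `𝒟` if `Γ'` is
(`PathGeometry.field_mem_distribution_of_reparamTo`).
-/

namespace PathGeom

/-! ### A homogeneous function on the slit tangent bundle -/

section HomogeneousFunction

variable {n : ℕ} {M : Type*} [TopologicalSpace M] [ChartedSpace (Base n) M]

/-- On a Hausdorff manifold a compact subset `K` of an open set `U` carries a smooth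
nonnegative function that is positive on `K` and supported in `U`. -/
lemma exists_contMDiff_pos_on_isCompact [T2Space M] [IsManifold (𝓡 n) ∞ M] {K U : Set M}
    (hK : IsCompact K) (hU : IsOpen U) (hKU : K ⊆ U) :
    ∃ f : M → ℝ, ContMDiff (𝓡 n) 𝓘(ℝ, ℝ) ∞ f ∧ (∀ x, 0 ≤ f x) ∧ (∀ x ∈ K, 0 < f x) ∧
      tsupport f ⊆ U := by
  have hb : ∀ x ∈ K, ∃ f : SmoothBumpFunction (𝓡 n) x, tsupport f ⊆ U := fun x hx => by
    obtain ⟨f, -, hf⟩ :=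
      (SmoothBumpFunction.nhds_basis_tsupport (I := 𝓡 n) x).mem_iff.1 (hU.mem_nhds (hKU hx))
    exact ⟨f, hf⟩
  choose! f hf using hb
  obtain ⟨t, htK, ht⟩ := hK.elim_nhds_subcover (fun x => Function.support (f x))
    fun x _ => (f x).support_mem_nhds
  refine ⟨fun x => ∑ i ∈ t, f i x, ?_, fun x => Finset.sum_nonneg fun i _ => (f i).nonneg, ?_, ?_⟩
  · exact contMDiff_finsetSum fun i _ => (f i).contMDiff
  · intro x hx
    obtain ⟨i, hi, hxi⟩ := mem_iUnion₂.1 (ht hx)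
    exact Finset.sum_pos' (fun i _ => (f i).nonneg) ⟨i, hi, (f i).nonneg.lt_of_ne' hxi⟩
  · have h1 : Function.support (fun x => ∑ i ∈ t, f i x) ⊆ ⋃ i ∈ t, tsupport (f i) := by
      intro x hx
      obtain ⟨i, hi, hxi⟩ := Finset.exists_ne_zero_of_sum_ne_zero hx
      exact mem_iUnion₂.2 ⟨i, hi, subset_tsupport _ hxi⟩
    refine (closure_minimal h1 (t.finite_toSet.isClosed_biUnion fun i _ =>
      isClosed_tsupport _)).trans (iUnion₂_subset fun i hi => hf i (htK i hi))

/-- Smooth functions subordinate to the preferred charts, with locally finite supports and without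
common zeros: a partition of unity before normalization. Mathlib's smooth partitions of unity assume
`σ`-compactness, which a paracompact manifold with uncountably many components lacks. -/
lemma exists_locallyFinite_contMDiff_pos [T2Space M] [ParacompactSpace M]
    [IsManifold (𝓡 n) ∞ M] :
    ∃ ρ : M → M → ℝ, (∀ i, ContMDiff (𝓡 n) 𝓘(ℝ, ℝ) ∞ (ρ i)) ∧ (∀ i x, 0 ≤ ρ i x) ∧
      (∀ i, tsupport (ρ i) ⊆ (chartAt (Base n) i).source) ∧
      LocallyFinite (fun i => Function.support (ρ i)) ∧ ∀ x, ∃ i, 0 < ρ i x := by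
  have : LocallyCompactSpace M := ChartedSpace.locallyCompactSpace (Base n) M
  choose K hKn hKs hKc using fun x : M =>
    local_compact_nhds ((chartAt (Base n) x).open_source.mem_nhds (mem_chart_source _ x))
  obtain ⟨V, hVo, hVc, hVf, hVs⟩ := precise_refinement (fun x => interior (K x))
    (fun _ => isOpen_interior)
    (iUnion_eq_univ_iff.2 fun x => ⟨x, mem_interior_iff_mem_nhds.2 (hKn x)⟩)
  obtain ⟨W, hWc, -, hWV⟩ := exists_iUnion_eq_closure_subset hVo
    (fun x => hVf.point_finite x) hVc
  have hW : ∀ x, IsCompact (closure (W x)) := fun x =>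
    (hKc x).of_isClosed_subset isClosed_closure
      ((hWV x).trans ((hVs x).trans interior_subset))
  choose ρ hρ h0 hpos hsupp using fun x =>
    exists_contMDiff_pos_on_isCompact (n := n) (hW x) (hVo x) (hWV x)
  refine ⟨ρ, hρ, h0, fun i => (hsupp i).trans ((hVs i).trans (interior_subset.trans (hKs i))),
    hVf.subset fun i => (subset_tsupport _).trans (hsupp i), fun x => ?_⟩
  obtain ⟨i, hi⟩ := mem_iUnion.1 (hWc.symm ▸ mem_univ x : x ∈ ⋃ i, W i)
  exact ⟨i, hpos i x (subset_closure hi)⟩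

variable [IsManifold (𝓡 n) ∞ M]

lemma contMDiff_slitProj : ContMDiff (𝓡 n).tangent (𝓡 n) ∞ (slitProj : SlitTangent n M → M) :=
  (Bundle.contMDiff_proj (TangentSpace (𝓡 n) : M → Type _)).comp contMDiff_subtype_val

/-- The coordinates `(x, v)` on `T°M` induced by the preferred chart of `TM` around `p`. -/
noncomputable def coords (p : TangentBundle (𝓡 n) M) (q : SlitTangent n M) :
    Base n × Base n := tchart p q.1

lemma coords_scale (p : TangentBundle (𝓡 n) M) (c : ℝ) (hc : 0 < c) (q : SlitTangent n M) :
    coords p (scale c hc q) = ((coords p q).1, c • (coords p q).2) :=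
  Prod.ext rfl (tchart_smul p q.1.1 q.1.2 c)

lemma contMDiffOn_coords (p : TangentBundle (𝓡 n) M) :
    ContMDiffOn (𝓡 n).tangent 𝓘(ℝ, Base n × Base n) ∞ (coords p : SlitTangent n M → _)
      {q | q.1 ∈ (tchart p).source} :=
  (contMDiffOn_extChartAt (I := (𝓡 n).tangent) (x := p)).comp
    contMDiff_subtype_val.contMDiffOn fun _ hq => hq

lemma tchart_source_mem_nhds {p : TangentBundle (𝓡 n) M} {q : SlitTangent n M}
    (hq : q.1 ∈ (tchart p).source) : {r : SlitTangent n M | r.1 ∈ (tchart p).source} ∈ 𝓝 q :=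
  ((tchart p).open_source.preimage continuous_subtype_val).mem_nhds hq

lemma contMDiffAt_coords {p : TangentBundle (𝓡 n) M} {q : SlitTangent n M}
    (hq : q.1 ∈ (tchart p).source) :
    ContMDiffAt (𝓡 n).tangent 𝓘(ℝ, Base n × Base n) ∞ (coords p : SlitTangent n M → _) q :=
  (contMDiffOn_coords p).contMDiffAt (tchart_source_mem_nhds hq)

/-- The square of the norm of a Riemannian metric, restricted to nonzero vectors: a smooth positive
function on `T°M`, homogeneous of degree two. -/
lemma exists_homogeneous_contMDiff_pos [T2Space M] [ParacompactSpace M] :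
    ∃ N : SlitTangent n M → ℝ, ContMDiff (𝓡 n).tangent 𝓘(ℝ, ℝ) ∞ N ∧ (∀ p, 0 < N p) ∧
      ∀ (c : ℝ) (hc : 0 < c) (p : SlitTangent n M), N (scale c hc p) = c ^ 2 * N p := by
  obtain ⟨ρ, hρ, h0, hs, hf, hpos⟩ := exists_locallyFinite_contMDiff_pos (n := n) (M := M)
  let e : M → TangentBundle (𝓡 n) M := fun i => ⟨i, 0⟩
  let g : M → SlitTangent n M → ℝ := fun i p => ρ i (slitProj p) * ‖(coords (e i) p).2‖ ^ 2
  have hcont : Continuous (slitProj : SlitTangent n M → M) := contMDiff_slitProj.continuous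
  have hgs : ∀ i, Function.support (g i) ⊆ slitProj ⁻¹' Function.support (ρ i) :=
    fun i p hp => left_ne_zero_of_mul hp
  have hgf : LocallyFinite fun i => Function.support (g i) :=
    (hf.preimage_continuous hcont).subset hgs
  have hg : ∀ i, ContMDiff (𝓡 n).tangent 𝓘(ℝ, ℝ) ∞ (g i) := by
    intro i
    refine contMDiff_of_tsupport fun p hp => ?_
    have hp' : slitProj p ∈ tsupport (ρ i) :=
      closure_minimal ((hgs i).trans (preimage_mono (subset_tsupport _)))
        ((isClosed_tsupport _).preimage hcont) hp
    have hmem : p.1 ∈ (tchart (e i)).source :=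
      (TangentBundle.mem_chart_source_iff _ _).2 (hs i hp')
    have h1 : ContMDiffAt (𝓡 n).tangent 𝓘(ℝ, Base n × Base n) ∞
        (coords (e i) : SlitTangent n M → _) p :=
      contMDiffAt_coords hmem
    have h2 : ContMDiffAt (𝓡 n).tangent 𝓘(ℝ, ℝ) ∞
        (fun q : SlitTangent n M => ‖(coords (e i) q).2‖ ^ 2) p :=
      (((contDiff_norm_sq ℝ).comp contDiff_snd).contMDiff (n := ∞)).contMDiffAt.comp
        p h1
    exact (((hρ i).comp contMDiff_slitProj).contMDiffAt).mul h2
  have hg0 : ∀ i p, 0 ≤ g i p := fun i p => mul_nonneg (h0 i _) (sq_nonneg _)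
  refine ⟨fun p => ∑ᶠ i, g i p, contMDiff_finsum hg hgf, fun p => ?_, fun c hc p => ?_⟩
  · obtain ⟨i, hi⟩ := hpos (slitProj p)
    refine finsum_pos (fun i => hg0 i p) ⟨i, mul_pos hi (pow_pos (norm_pos_iff.2 ?_) 2)⟩
      (hgf.point_finite p)
    have hmem : p.1 ∈ (tchart (e i)).source :=
      (TangentBundle.mem_chart_source_iff _ _).2 (hs i (subset_tsupport _ hi.ne'))
    exact fun h => p.2 ((tchart_snd_eq_zero_iff _ _ hmem).1 h)
  · change ∑ᶠ i, g i (scale c hc p) = c ^ 2 * ∑ᶠ i, g i p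
    rw [mul_finsum]
    refine finsum_congr fun i => ?_
    change ρ i (slitProj p) * ‖(coords (e i) (scale c hc p)).2‖ ^ 2 = c ^ 2 * (_ * _)
    rw [coords_scale, norm_smul, mul_pow, Real.norm_eq_abs, sq_abs]
    ring

end HomogeneousFunction

/-! ### The leaves of an oriented foliation -/

section Leaves

variable {V : Type*} [NormedAddCommGroup V] [NormedSpace ℝ V] {N : Type*}
  [TopologicalSpace N] [ChartedSpace V N] {k : ℕ}

lemma OrientedFoliation.mdifferentiable (F : OrientedFoliation V N k)
    {φ : OpenPartialHomeomorph N (ℝ × Base k)} (hφ : φ ∈ F.charts) :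
    φ.MDifferentiable 𝓘(ℝ, V) 𝓘(ℝ, ℝ × Base k) :=
  ⟨(F.smooth φ hφ).mdifferentiableOn (by simp), (F.smooth_symm φ hφ).mdifferentiableOn (by simp)⟩

/-- The unit tangent vector to the plaque of the foliated chart `φ` through `s`, in the positive
direction. -/
noncomputable def plaqueVector (φ : OpenPartialHomeomorph N (ℝ × Base k)) (s : N) :
    TangentSpace 𝓘(ℝ, V) s :=
  mfderiv 𝓘(ℝ, ℝ × Base k) 𝓘(ℝ, V) φ.symm (φ s) ((1, 0) : ℝ × Base k)

lemma OrientedFoliation.mfderiv_plaqueVector_self (F : OrientedFoliation V N k)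
    {φ : OpenPartialHomeomorph N (ℝ × Base k)} (hφ : φ ∈ F.charts) {s : N} (hs : s ∈ φ.source) :
    (mfderiv 𝓘(ℝ, V) 𝓘(ℝ, ℝ × Base k) φ s (plaqueVector φ s) : ℝ × Base k) = (1, 0) := by
  have h := (F.mdifferentiable hφ).symm.symm_comp_deriv (φ.map_source hs)
  have h2 := DFunLike.congr_fun h ((1, 0) : ℝ × Base k)
  simp only [OpenPartialHomeomorph.symm_symm] at h2
  rw [φ.left_inv hs] at h2
  exact h2

/-- The compatibility of foliated charts, which compares points of the same plaque, says
infinitesimally that the oriented plaque directions of two charts agree. -/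
lemma OrientedFoliation.mfderiv_plaqueVector (F : OrientedFoliation V N k)
    {φ ψ : OpenPartialHomeomorph N (ℝ × Base k)} (hφ : φ ∈ F.charts) (hψ : ψ ∈ F.charts)
    {s : N} (hs : s ∈ φ.source) (hs' : s ∈ ψ.source) :
    0 < (mfderiv 𝓘(ℝ, V) 𝓘(ℝ, ℝ × Base k) ψ s (plaqueVector φ s) : ℝ × Base k).1 ∧
      (mfderiv 𝓘(ℝ, V) 𝓘(ℝ, ℝ × Base k) ψ s (plaqueVector φ s) : ℝ × Base k).2 = 0 := by
  set u : ℝ × Base k := mfderiv 𝓘(ℝ, V) 𝓘(ℝ, ℝ × Base k) ψ s (plaqueVector φ s) with hu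
  obtain ⟨W, hW, hWs, hcomp⟩ := F.compatible φ hφ ψ hψ s ⟨hs, hs'⟩
  let β : ℝ → ℝ × Base k := fun t => φ s + t • ((1, 0) : ℝ × Base k)
  have hβ0 : β 0 = φ s := by simp [β]
  have hβd : HasDerivAt β ((1, 0) : ℝ × Base k) 0 := by
    have h := ((hasDerivAt_id (0 : ℝ)).smul_const ((1, 0) : ℝ × Base k)).const_add (φ s)
    rw [one_smul] at h
    exact h
  have h1 := ((F.mdifferentiable hφ).mdifferentiableAt_symm (φ.map_source hs)).hasMFDerivAt
  have h2 := ((F.mdifferentiable hψ).mdifferentiableAt hs').hasMFDerivAt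
  rw [← φ.left_inv hs] at h2
  have h3 := (h2.comp _ h1).hasFDerivAt
  rw [← hβ0] at h3
  have h4 : HasDerivAt (fun t => ψ (φ.symm (β t))) u 0 := by
    refine (h3.comp_hasDerivAt (0 : ℝ) hβd).congr_deriv ?_
    rw [hβ0]
    have key : ∀ x : N, x = s →
        (mfderiv 𝓘(ℝ, V) 𝓘(ℝ, ℝ × Base k) ψ x (plaqueVector (V := V) φ s : V) : ℝ × Base k) =
          u := by
      rintro _ rfl
      rfl
    exact key _ (φ.left_inv hs)
  -- The plaque through `s` stays in the neighbourhood `W` where the charts are compatible.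
  have hev : ∀ᶠ t in 𝓝 (0 : ℝ), φ.symm (β t) ∈ W ∧ β t ∈ φ.target := by
    have hc : ContinuousAt (fun t => φ.symm (β t)) 0 := by
      refine ContinuousAt.comp (g := φ.symm) ?_ hβd.continuousAt
      rw [hβ0]
      exact φ.continuousAt_symm (φ.map_source hs)
    refine Filter.Eventually.and (hc.preimage_mem_nhds ?_)
      (hβd.continuousAt.preimage_mem_nhds ?_)
    · rwa [hβ0, φ.left_inv hs]
    · rw [hβ0]
      exact φ.open_target.mem_nhds (φ.map_source hs)
  obtain ⟨ε, hε, hball⟩ := Metric.eventually_nhds_iff_ball.1 hev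
  have h0 : (0 : ℝ) ∈ Metric.ball (0 : ℝ) ε := Metric.mem_ball_self hε
  have hφβ : ∀ t ∈ Metric.ball (0 : ℝ) ε, φ (φ.symm (β t)) = β t := fun t ht =>
    φ.right_inv (hball t ht).2
  have hβ2 : ∀ t, (β t).2 = (φ s).2 := fun t => by simp [β]
  have hβ1 : ∀ t, (β t).1 = (φ s).1 + t := fun t => by simp [β]
  have hle : ∀ a ∈ Metric.ball (0 : ℝ) ε, ∀ b ∈ Metric.ball (0 : ℝ) ε,
      (ψ (φ.symm (β a))).2 = (ψ (φ.symm (β b))).2 ∧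
        (a ≤ b → (ψ (φ.symm (β a))).1 ≤ (ψ (φ.symm (β b))).1) := fun a ha b hb => by
    have := hcomp _ (hball a ha).1 _ (hball b hb).1 (by rw [hφβ a ha, hφβ b hb, hβ2, hβ2])
    refine ⟨this.1, fun hab => this.2 ?_⟩
    rw [hφβ a ha, hφβ b hb, hβ1, hβ1]
    linarith
  have hball0 : Metric.ball (0 : ℝ) ε ∈ 𝓝 (0 : ℝ) := Metric.ball_mem_nhds _ hε
  have h4' : HasFDerivAt (fun t => ψ (φ.symm (β t)))
    ((ContinuousLinearMap.toSpanSingleton ℝ u)) 0 := h4.hasFDerivAt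
  have hd2 : u.2 = 0 := by
    have h5 : HasDerivAt (fun t => (ψ (φ.symm (β t))).2) u.2 0 := by
      simpa using h4'.snd.hasDerivAt
    refine h5.unique ((hasDerivAt_const (0 : ℝ) (ψ (φ.symm (β 0))).2).congr_of_eventuallyEq ?_)
    filter_upwards [hball0] with t ht
    exact (hle t ht 0 h0).1
  have hd1 : 0 ≤ u.1 := by
    have h5 : HasDerivAt (fun t => (ψ (φ.symm (β t))).1) u.1 0 := by
      simpa using h4'.fst.hasDerivAt
    refine h5.hasDerivWithinAt.nonneg_of_monotoneOn (s := Metric.ball (0 : ℝ) ε) ?_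
      fun a ha b hb hab => (hle a ha b hb).2 hab
    exact uniqueDiffWithinAt_iff_accPt.1 (Metric.isOpen_ball.uniqueDiffWithinAt h0)
  refine ⟨hd1.lt_of_ne' fun h => ?_, hd2⟩
  have hz : plaqueVector (V := V) φ s = 0 :=
    (F.mdifferentiable hψ).mfderiv_injective hs'
      ((Prod.ext h hd2 : u = 0).trans (map_zero _).symm)
  have h6 := F.mfderiv_plaqueVector_self hφ hs
  rw [hz, map_zero] at h6
  exact one_ne_zero (congrArg Prod.fst h6).symm

/-- The oriented tangent line of the leaf through `s`: it has a positive generator `u`, and every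
vector tangent to the plaque of a single foliated chart is a multiple of `u`. -/
lemma OrientedFoliation.exists_isPositive (F : OrientedFoliation V N k) (s : N) :
    ∃ u : TangentSpace 𝓘(ℝ, V) s, F.IsPositive s u ∧ ∀ φ ∈ F.charts, s ∈ φ.source →
      ∀ v : TangentSpace 𝓘(ℝ, V) s,
        (mfderiv 𝓘(ℝ, V) 𝓘(ℝ, ℝ × Base k) φ s v : ℝ × Base k).2 = 0 → ∃ a : ℝ, v = a • u := by
  obtain ⟨φ, hφ, hs⟩ := F.cover s
  refine ⟨plaqueVector φ s, ⟨fun ψ hψ hs' => (F.mfderiv_plaqueVector hφ hψ hs hs').2,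
    fun ψ hψ hs' => (F.mfderiv_plaqueVector hφ hψ hs hs').1⟩, fun ψ hψ hs' v hv => ?_⟩
  obtain ⟨h1, h2⟩ := F.mfderiv_plaqueVector hφ hψ hs hs'
  set b : ℝ := (mfderiv 𝓘(ℝ, V) 𝓘(ℝ, ℝ × Base k) ψ s (plaqueVector φ s) : ℝ × Base k).1
  set a : ℝ := (mfderiv 𝓘(ℝ, V) 𝓘(ℝ, ℝ × Base k) ψ s v : ℝ × Base k).1 with ha
  refine ⟨a / b, (F.mdifferentiable hψ).mfderiv_injective hs' ?_⟩
  rw [map_smul]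
  refine Prod.ext ?_ ?_
  · exact ha.symm.trans (div_mul_cancel₀ a h1.ne').symm
  · exact hv.trans ((congrArg ((a / b) • ·) h2).trans (smul_zero _)).symm

end Leaves

/-! ### The Liouville field and the kernel of the projection to the sphere bundle -/

section Liouville

variable {n : ℕ} {M : Type*} [TopologicalSpace M] [ChartedSpace (Base n) M]
  [IsManifold (𝓡 n) ∞ M]

lemma mem_extChartAt_slit_source (p q : SlitTangent n M) :
    q ∈ (extChartAt (𝓡 n).tangent p).source ↔ q.1 ∈ (tchart p.1).source := by
  rw [extChartAt_source]
  change q ∈ ((chartAt (ModelProd (Base n) (Base n)) p.1).subtypeRestr ⟨p⟩).source ↔ _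
  rw [OpenPartialHomeomorph.subtypeRestr_source]
  rfl

lemma scale_mem_tchart_source {p : TangentBundle (𝓡 n) M} {q : SlitTangent n M} (c : ℝ)
    (hc : 0 < c) : (scale c hc q).1 ∈ (tchart p).source ↔ q.1 ∈ (tchart p).source := by
  rw [TangentBundle.mem_chart_source_iff, TangentBundle.mem_chart_source_iff]
  rfl

lemma mdifferentiableAt_coords {p : TangentBundle (𝓡 n) M} {q : SlitTangent n M}
    (hq : q.1 ∈ (tchart p).source) :
    MDifferentiableAt (𝓡 n).tangent 𝓘(ℝ, Base n × Base n) (coords p : SlitTangent n M → _) q :=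
  (contMDiffAt_coords hq).mdifferentiableAt (by simp)

lemma isInvertible_mfderiv_coords {p q : SlitTangent n M} (hq : q.1 ∈ (tchart p.1).source) :
    (mfderiv (𝓡 n).tangent 𝓘(ℝ, Base n × Base n)
      (coords p.1 : SlitTangent n M → _) q).IsInvertible :=
  isInvertible_mfderiv_extChartAt (I := (𝓡 n).tangent)
    ((mem_extChartAt_slit_source p q).2 hq)

lemma mdifferentiableAt_scale_exp (p : SlitTangent n M) :
    MDifferentiableAt 𝓘(ℝ, ℝ) (𝓡 n).tangent
      (fun t : ℝ => scale (Real.exp t) (Real.exp_pos t) p) 0 := by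
  have hs : ∀ t : ℝ, scale (Real.exp t) (Real.exp_pos t) p ∈
      (extChartAt (𝓡 n).tangent p).source := fun t =>
    (mem_extChartAt_slit_source p _).2
      ((scale_mem_tchart_source _ _).2 (mem_chart_source _ p.1))
  let β : ℝ → Base n × Base n := fun t => ((coords p.1 p).1, Real.exp t • (coords p.1 p).2)
  have hβ : ∀ t, extChartAt (𝓡 n).tangent p (scale (Real.exp t) (Real.exp_pos t) p) = β t :=
    fun t => coords_scale p.1 _ (Real.exp_pos t) p
  have heq : (fun t : ℝ => scale (Real.exp t) (Real.exp_pos t) p) =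
      (extChartAt (𝓡 n).tangent p).symm ∘ β := funext fun t => by
    rw [Function.comp_apply, ← hβ t, (extChartAt (𝓡 n).tangent p).left_inv (hs t)]
  have hβd : MDifferentiableAt 𝓘(ℝ, ℝ) 𝓘(ℝ, Base n × Base n) β 0 :=
    ((differentiable_const _).prodMk
      (Real.differentiable_exp.smul_const _)).differentiableAt.mdifferentiableAt
  have ht : β 0 ∈ (extChartAt (𝓡 n).tangent p).target := by
    rw [← hβ]
    exact (extChartAt (𝓡 n).tangent p).map_source (hs 0)
  have hsym : MDifferentiableAt 𝓘(ℝ, Base n × Base n) (𝓡 n).tangent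
      (extChartAt (𝓡 n).tangent p).symm (β 0) :=
    ((contMDiffOn_extChartAt_symm (n := ∞) p).contMDiffAt
      ((isOpen_extChartAt_target p).mem_nhds ht)).mdifferentiableAt (by simp)
  rw [heq]
  exact hsym.comp 0 hβd

/-- The derivative of a function along the Liouville field is its derivative along the flow. -/
lemma mfderiv_liouville {E' H' N' : Type*} [NormedAddCommGroup E'] [NormedSpace ℝ E']
    [TopologicalSpace H'] {I' : ModelWithCorners ℝ E' H'} [TopologicalSpace N']
    [ChartedSpace H' N'] {f : SlitTangent n M → N'} {p : SlitTangent n M}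
    (hf : MDifferentiableAt (𝓡 n).tangent I' f p) {g : ℝ → N'} {L : ℝ →L[ℝ] E'}
    (hg : ∀ t, f (scale (Real.exp t) (Real.exp_pos t) p) = g t)
    (h : HasMFDerivAt 𝓘(ℝ, ℝ) I' g 0 L) :
    (mfderiv (𝓡 n).tangent I' f p (liouville p) : E') = L 1 := by
  obtain rfl : (fun t => f (scale (Real.exp t) (Real.exp_pos t) p)) = g := funext hg
  have h0 : scale (Real.exp 0) (Real.exp_pos 0) p = p := by
    rw [scale_congr Real.exp_zero, scale_one]
  have hc := (mdifferentiableAt_scale_exp p).hasMFDerivAt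
  have key : ∀ q, q = p → HasMFDerivAt (𝓡 n).tangent I' f q
      (mfderiv (𝓡 n).tangent I' f p : Base n × Base n →L[ℝ] E') := by
    rintro _ rfl
    exact hf.hasMFDerivAt
  have h1 := (key _ h0).comp (0 : ℝ) hc
  have h2 := hasMFDerivAt_unique h1 h
  exact DFunLike.congr_fun h2 (1 : ℝ)

lemma mfderiv_ray_liouville (p : SlitTangent n M) :
    mfderiv (𝓡 n).tangent 𝓘(ℝ, Base n × Base (n - 1)) (ray : SlitTangent n M → _) p
      (liouville p) = 0 :=
  mfderiv_liouville (L := 0) (contMDiff_ray.mdifferentiable (by simp) p)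
    (fun _ => ray_scale _ _ p) (hasMFDerivAt_const (ray p) _)

lemma mfderiv_coords_liouville {p : TangentBundle (𝓡 n) M} {q : SlitTangent n M}
    (hq : q.1 ∈ (tchart p).source) :
    (mfderiv (𝓡 n).tangent 𝓘(ℝ, Base n × Base n) (coords p : SlitTangent n M → _) q
      (liouville q) : Base n × Base n) = (0, (coords p q).2) := by
  have hd : HasDerivAt (fun t : ℝ => ((coords p q).1, Real.exp t • (coords p q).2))
      (0, (coords p q).2) 0 := by
    have := (hasDerivAt_const (0 : ℝ) (coords p q).1).prodMk
      ((Real.hasDerivAt_exp 0).smul_const (coords p q).2)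
    rwa [Real.exp_zero, one_smul] at this
  exact (mfderiv_liouville (mdifferentiableAt_coords hq) (fun _ => coords_scale p _ _ q)
    hd.hasFDerivAt.hasMFDerivAt).trans (one_smul ℝ _)

/-- Euler's identity for a function of degree two. -/
lemma mfderiv_liouville_of_homogeneous {N : SlitTangent n M → ℝ} {p : SlitTangent n M}
    (hN : MDifferentiableAt (𝓡 n).tangent 𝓘(ℝ, ℝ) N p)
    (h : ∀ (c : ℝ) (hc : 0 < c), N (scale c hc p) = c ^ 2 * N p) :
    (mfderiv (𝓡 n).tangent 𝓘(ℝ, ℝ) N p (liouville p) : ℝ) = 2 * N p := by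
  have hd : HasDerivAt (fun t : ℝ => Real.exp t ^ 2 * N p) (2 * N p) 0 := by
    simpa using ((Real.hasDerivAt_exp 0).pow 2).mul_const (N p)
  exact (mfderiv_liouville hN (fun _ => h _ _) hd.hasFDerivAt.hasMFDerivAt).trans (one_smul ℝ _)

/-- The kernel of the derivative of `dirFun y hy` at `y` is the line of `y`. -/
lemma exists_smul_eq_of_fderiv_dirFun_eq_zero {y : Base n} (hy : y ≠ 0) {w : Base n}
    (hw : fderiv ℝ (dirFun y hy) y w = 0) : ∃ a : ℝ, w = a • y := by
  have hpos : 0 < inner ℝ y y := real_inner_self_pos.2 hy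
  have hopen : {v : Base n | 0 < inner ℝ y v} ∈ 𝓝 y :=
    (isOpen_lt continuous_const (continuous_const.inner continuous_id)).mem_nhds hpos
  have h1 : HasFDerivAt (dirFun y hy) (fderiv ℝ (dirFun y hy) y) y :=
    (((contDiffOn_dirFun y hy).contDiffAt hopen).differentiableAt (by simp)).hasFDerivAt
  have h2 : HasFDerivAt (dirSec y hy) (fderiv ℝ (dirSec y hy) (dirFun y hy y)) (dirFun y hy y) :=
    ((contDiff_dirSec y hy).differentiable (by simp) _).hasFDerivAt
  -- A vector of the half space is recovered from its direction and its component along `y`.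
  have h3 : HasFDerivAt (fun v => (innerSL ℝ y v) • dirSec y hy (dirFun y hy v))
      (ContinuousLinearMap.id ℝ (Base n)) y := by
    refine (hasFDerivAt_id y).congr_of_eventuallyEq ?_
    filter_upwards [hopen] with v hv
    rw [innerSL_apply_apply, dirSec_dirFun y hy v hv, smul_smul, mul_inv_cancel₀ (ne_of_gt hv),
      one_smul, id]
  have h4 := ((innerSL ℝ y).hasFDerivAt (x := y)).smul (h2.comp y h1)
  have h5 := DFunLike.congr_fun (h3.unique h4) w
  simp only [_root_.add_apply, _root_.smul_apply,
    ContinuousLinearMap.smulRight_apply, ContinuousLinearMap.comp_apply, hw, map_zero, smul_zero,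
    zero_add, Function.comp_apply, ContinuousLinearMap.id_apply,
    dirSec_dirFun y hy y hpos, smul_smul] at h5
  exact ⟨_, h5⟩

lemma exists_smul_liouville_of_mfderiv_ray_eq_zero {p : SlitTangent n M}
    {v : TangentSpace (𝓡 n).tangent p}
    (hv : mfderiv (𝓡 n).tangent 𝓘(ℝ, Base n × Base (n - 1)) (ray : SlitTangent n M → _) p v = 0) :
    ∃ a : ℝ, v = a • liouville p := by
  have hp : p.1 ∈ (tchart p.1).source := mem_chart_source _ p.1
  have hd := dirAt_ne_zero p
  set w : Base n × Base n :=
    mfderiv (𝓡 n).tangent 𝓘(ℝ, Base n × Base n) (coords p.1 : SlitTangent n M → _) p v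
  have hpos : {v : Base n | 0 < inner ℝ (dirAt p) v} ∈ 𝓝 (dirAt p) :=
    (isOpen_lt continuous_const (continuous_const.inner continuous_id)).mem_nhds
      (real_inner_self_pos.2 hd)
  have hdir : HasFDerivAt (dirFun (dirAt p) hd) (fderiv ℝ (dirFun (dirAt p) hd) (dirAt p))
      (dirAt p) :=
    (((contDiffOn_dirFun _ hd).contDiffAt hpos).differentiableAt (by simp)).hasFDerivAt
  -- The chart of `STM` composed with `ray`, differentiated in two ways.
  have h1 : HasMFDerivAt (𝓡 n).tangent 𝓘(ℝ, Base n × Base (n - 1)) (preChart p) p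
      (((ContinuousLinearMap.fst ℝ (Base n) (Base n)).prod
        ((fderiv ℝ (dirFun (dirAt p) hd) (dirAt p)).comp
          (ContinuousLinearMap.snd ℝ (Base n) (Base n)))).comp
        (mfderiv (𝓡 n).tangent 𝓘(ℝ, Base n × Base n) (coords p.1 : SlitTangent n M → _) p)) := by
    have h2 : HasFDerivAt (fun z : Base n × Base n => (z.1, dirFun (dirAt p) hd z.2))
        ((ContinuousLinearMap.fst ℝ (Base n) (Base n)).prod
        ((fderiv ℝ (dirFun (dirAt p) hd) (dirAt p)).comp
          (ContinuousLinearMap.snd ℝ (Base n) (Base n)))) (coords p.1 p) :=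
      hasFDerivAt_fst.prodMk (HasFDerivAt.comp (g := dirFun (dirAt p) hd) _ hdir hasFDerivAt_snd)
    exact h2.hasMFDerivAt.comp p (mdifferentiableAt_coords hp).hasMFDerivAt
  have h3 : MDifferentiableAt 𝓘(ℝ, Base n × Base (n - 1)) 𝓘(ℝ, Base n × Base (n - 1))
      (sphereChart p) (ray p) :=
    mdifferentiableAt_atlas (mem_range_self p) ⟨p, mem_preSource_self p, rfl⟩
  have h4 := h3.hasMFDerivAt.comp p (contMDiff_ray.mdifferentiable (by simp) p).hasMFDerivAt
  have h5 : sphereChart p ∘ (ray : SlitTangent n M → _) = preChart p :=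
    funext fun q => preChart_rep p q
  rw [h5] at h4
  have h6 := DFunLike.congr_fun (hasMFDerivAt_unique h1 h4) v
  have h7 : ((w.1, fderiv ℝ (dirFun (dirAt p) hd) (dirAt p) w.2) : Base n × Base (n - 1)) = 0 := by
    exact h6.trans ((congrArg (mfderiv 𝓘(ℝ, Base n × Base (n - 1)) 𝓘(ℝ, Base n × Base (n - 1))
      (sphereChart p) (ray p)) hv).trans (map_zero _))
  obtain ⟨a, ha⟩ := exists_smul_eq_of_fderiv_dirFun_eq_zero hd (congrArg Prod.snd h7)
  refine ⟨a, (isInvertible_mfderiv_coords hp).injective ?_⟩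
  rw [map_smul]
  have h8 : w = a • ((0, (coords p.1 p).2) : Base n × Base n) :=
    Prod.ext ((congrArg Prod.fst h7).trans (smul_zero a).symm) ha
  rw [← mfderiv_coords_liouville hp] at h8
  exact h8

end Liouville

section SprayDistribution

variable {n : ℕ} {M : Type*} [TopologicalSpace M] [ChartedSpace (Base n) M]
  [IsManifold (𝓡 n) ∞ M]

/-! ### The distribution of a path geometry -/

section Distribution

lemma slitVec_ne_zero (p : SlitTangent n M) : slitVec p ≠ 0 := p.2

lemma mfderiv_slitProj_eq (p : SlitTangent n M) (v : TangentSpace (𝓡 n).tangent p) :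
    (mfderiv (𝓡 n).tangent (𝓡 n) (slitProj : SlitTangent n M → M) p v : Base n) =
      mfderiv 𝓘(ℝ, Base n × Base (n - 1)) (𝓡 n) (sphereProj : SphereBundle n M → M) (ray p)
        (mfderiv (𝓡 n).tangent 𝓘(ℝ, Base n × Base (n - 1)) (ray : SlitTangent n M → _) p v) := by
  have h := (contMDiff_sphereProj.mdifferentiable (by simp) (ray p)).hasMFDerivAt.comp p
    (contMDiff_ray.mdifferentiable (by simp) p).hasMFDerivAt
  exact DFunLike.congr_fun
    (hasMFDerivAt_unique (contMDiff_slitProj.mdifferentiable (by simp) p).hasMFDerivAt h) v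

variable (F : PathGeometry n M) (p : SlitTangent n M)

/-- Membership in the distribution may be tested in any one foliated chart. -/
lemma PathGeometry.mem_distribution_of_chart
    {φ : OpenPartialHomeomorph (SphereBundle n M) (ℝ × Base (2 * n - 2))} (hφ : φ ∈ F.charts)
    (hs : ray p ∈ φ.source) {v : TangentSpace (𝓡 n).tangent p}
    (hv : (mfderiv 𝓘(ℝ, Base n × Base (n - 1)) 𝓘(ℝ, ℝ × Base (2 * n - 2)) φ (ray p)
      (mfderiv (𝓡 n).tangent 𝓘(ℝ, Base n × Base (n - 1)) (ray : SlitTangent n M → _) p v) :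
        ℝ × Base (2 * n - 2)).2 = 0) :
    v ∈ F.distribution p := by
  obtain ⟨u, hu, hspan⟩ := F.exists_isPositive (ray p)
  obtain ⟨a, ha⟩ := hspan φ hφ hs _ hv
  intro ψ hψ hs'
  have h := congrArg (a • ·) (hu.1 ψ hψ hs')
  rw [ha, map_smul]
  exact h.trans (smul_zero a)

lemma PathGeometry.liouville_mem_distribution : liouville p ∈ F.distribution p := by
  intro φ _ _
  rw [mfderiv_ray_liouville, map_zero]
  rfl

/-- A vector of the distribution projects to a multiple `b` of the vector at which it is based, and
is a multiple of the Liouville field if `b = 0`. -/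
lemma PathGeometry.exists_mfderiv_slitProj_eq_smul {v : TangentSpace (𝓡 n).tangent p}
    (hv : v ∈ F.distribution p) :
    ∃ b : ℝ, (mfderiv (𝓡 n).tangent (𝓡 n) (slitProj : SlitTangent n M → M) p v : Base n) =
      b • (slitVec p : Base n) ∧ (b = 0 → ∃ a : ℝ, v = a • liouville p) := by
  obtain ⟨u, hu, hspan⟩ := F.exists_isPositive (ray p)
  obtain ⟨c, hc, huc⟩ := F.second_order p u hu
  obtain ⟨φ, hφ, hs⟩ := F.cover (ray p)
  obtain ⟨a, ha⟩ := hspan φ hφ hs _ (hv φ hφ hs)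
  refine ⟨a * c, ?_, fun h => exists_smul_liouville_of_mfderiv_ray_eq_zero ?_⟩
  · rw [mfderiv_slitProj_eq, ha, map_smul, huc, mul_smul]
    rfl
  · rw [ha, (mul_eq_zero.1 h).resolve_right hc.ne', zero_smul]

/-- A vector of the distribution is determined by its projection to `M` up to the addition of
multiples of the Liouville field. -/
lemma PathGeometry.exists_smul_liouville_of_mem_distribution {v : TangentSpace (𝓡 n).tangent p}
    (hv : v ∈ F.distribution p)
    (h : mfderiv (𝓡 n).tangent (𝓡 n) (slitProj : SlitTangent n M → M) p v = 0) :
    ∃ a : ℝ, v = a • liouville p := by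
  obtain ⟨b, hb, hb0⟩ := F.exists_mfderiv_slitProj_eq_smul p hv
  exact hb0 ((smul_eq_zero.1 (hb.symm.trans h)).resolve_right (slitVec_ne_zero p))

lemma PathGeometry.distribution_eq_span {v : TangentSpace (𝓡 n).tangent p}
    (hv : v ∈ F.distribution p)
    (h : mfderiv (𝓡 n).tangent (𝓡 n) (slitProj : SlitTangent n M → M) p v = slitVec p) :
    F.distribution p = Submodule.span ℝ {liouville p, v} := by
  refine le_antisymm (fun w hw => ?_) (Submodule.span_le.2 ?_)
  · obtain ⟨b, hb, -⟩ := F.exists_mfderiv_slitProj_eq_smul p hw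
    have hz : mfderiv (𝓡 n).tangent (𝓡 n) (slitProj : SlitTangent n M → M) p (w - b • v) = 0 := by
      rw [map_sub, map_smul, h]
      exact sub_eq_zero.2 hb
    obtain ⟨a, ha⟩ := F.exists_smul_liouville_of_mem_distribution p
      (sub_mem hw (Submodule.smul_mem _ b hv)) hz
    exact Submodule.mem_span_pair.2 ⟨a, b, by rw [← ha, sub_add_cancel]⟩
  · rintro _ (rfl | rfl)
    exacts [F.liouville_mem_distribution p, hv]

end Distribution

/-! ### Projectively equivalent sprays -/

section Projective

/-- The velocity of the projection of an integral curve of a spray is the curve itself. -/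
lemma Spray.hasMFDerivAt_slitProj_comp (Γ : Spray n M) {γ : ℝ → SlitTangent n M} {J : Set ℝ}
    (hJ : IsOpen J) (hγ : IsMIntegralCurveOn γ Γ.field J) {t : ℝ} (ht : t ∈ J) :
    HasMFDerivAt 𝓘(ℝ, ℝ) (𝓡 n) (fun t => slitProj (γ t)) t
      (ContinuousLinearMap.toSpanSingleton ℝ (slitVec (γ t) : Base n)) := by
  have h := (contMDiff_slitProj.mdifferentiable (by simp) (γ t)).hasMFDerivAt.comp t
    ((hγ t ht).hasMFDerivAt (hJ.mem_nhds ht))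
  refine h.congr_mfderiv (DFunLike.ext _ _ fun a : ℝ => ?_)
  refine (map_smul (mfderiv (𝓡 n).tangent (𝓡 n) (slitProj : SlitTangent n M → M) (γ t)) a
    (Γ.field (γ t))).trans ?_
  exact congrArg (fun v : Base n => a • v) (Γ.second_order (γ t))

lemma eq_scale_of_slitVec_eq {p q : SlitTangent n M} {c : ℝ} (hc : 0 < c)
    (h : slitProj p = slitProj q) (h' : (slitVec p : Base n) = c • (slitVec q : Base n)) :
    p = scale c hc q := by
  obtain ⟨⟨x, v⟩, hp⟩ := p
  obtain ⟨⟨y, w⟩, hq⟩ := q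
  obtain rfl : x = y := h
  exact Subtype.ext (congrArg (Bundle.TotalSpace.mk x) h')

/-- A reparametrized geodesic has a rescaled velocity, hence traces the same curve in the sphere
bundle; differentiating this equality, tangency to the leaves passes from one spray to the other. -/
lemma PathGeometry.field_mem_distribution_of_reparamTo (F : PathGeometry n M) {Γ Γ' : Spray n M}
    (h : Γ.ReparamTo Γ') (hΓ' : ∀ p, Γ'.field p ∈ F.distribution p) (p : SlitTangent n M) :
    Γ.field p ∈ F.distribution p := by
  obtain ⟨γ, hγ0, hγ⟩ := exists_isMIntegralCurveAt_of_contMDiffAt_boundaryless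
    (I := (𝓡 n).tangent) (t₀ := 0) ((Γ.smooth p).of_le (by simp))
  obtain ⟨ε, hε, hγ⟩ := isMIntegralCurveAt_iff'.1 hγ
  obtain ⟨J', r, hJ', -, hr, hr', hrJ, γ', hγ', hproj⟩ := h (Metric.ball 0 ε)
    (fun t => slitProj (γ t)) Metric.isOpen_ball (convex_ball _ _).ordConnected
    ⟨γ, hγ, fun _ _ => rfl⟩
  have hrd : ∀ t ∈ J', HasDerivAt r (deriv r t) t := fun t ht =>
    ((hr.differentiableOn (by simp)).differentiableAt (hJ'.mem_nhds ht)).hasDerivAt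
  have hmaps : ∀ t ∈ J', r t ∈ Metric.ball (0 : ℝ) ε := fun t ht => hrJ ▸ mem_image_of_mem r ht
  have hscale : ∀ t (ht : t ∈ J'), γ' t = scale (deriv r t) (hr' t ht) (γ (r t)) := by
    intro t ht
    refine eq_scale_of_slitVec_eq _ (hproj t ht) ?_
    have h1 := Γ'.hasMFDerivAt_slitProj_comp hJ' hγ' ht
    have h2 := (Γ.hasMFDerivAt_slitProj_comp Metric.isOpen_ball hγ (hmaps t ht)).comp t
      (hrd t ht).hasFDerivAt.hasMFDerivAt
    have h3 := h2.congr_of_eventuallyEq (f₁ := fun t => slitProj (γ' t))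
      (Filter.eventually_of_mem (hJ'.mem_nhds ht) fun s hs => hproj s hs)
    have h4 := DFunLike.congr_fun (hasMFDerivAt_unique h1 h3) (1 : ℝ)
    refine ((one_smul ℝ _).symm.trans h4).trans ?_
    change ((1 : ℝ) • deriv r t) • (slitVec (γ (r t)) : Base n) = _
    rw [one_smul]
  obtain ⟨t₀, ht₀, hrt₀⟩ : (0 : ℝ) ∈ r '' J' := hrJ ▸ Metric.mem_ball_self hε
  have hray := contMDiff_ray (n := n) (M := M) |>.mdifferentiable (by simp)
  -- The two ways of differentiating the curve `ray ∘ γ' = ray ∘ γ ∘ r` at `t₀`.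
  have h1 := (hray (γ' t₀)).hasMFDerivAt.comp t₀
    ((hγ' t₀ ht₀).hasMFDerivAt (hJ'.mem_nhds ht₀))
  have h2 := ((hray (γ (r t₀))).hasMFDerivAt.comp (r t₀)
    ((hγ _ (hmaps t₀ ht₀)).hasMFDerivAt (Metric.isOpen_ball.mem_nhds (hmaps t₀ ht₀)))).comp t₀
      (hrd t₀ ht₀).hasFDerivAt.hasMFDerivAt
  have h3 := h1.congr_of_eventuallyEq (f₁ := (ray ∘ γ) ∘ r)
    (Filter.eventually_of_mem (hJ'.mem_nhds ht₀) fun s hs => by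
      simp only [Function.comp_apply, hscale s hs, ray_scale])
  have h4 := DFunLike.congr_fun (hasMFDerivAt_unique h2 h3) (1 : ℝ)
  have hp : γ (r t₀) = p := by rw [hrt₀, hγ0]
  obtain ⟨φ, hφ, hs⟩ := F.cover (ray p)
  have hrp : ray (γ' t₀) = ray p := by rw [hscale t₀ ht₀, ray_scale, hp]
  subst hp
  have h5 : deriv r t₀ • (mfderiv (𝓡 n).tangent 𝓘(ℝ, Base n × Base (n - 1))
      (ray : SlitTangent n M → _) (γ (r t₀)) (Γ.field (γ (r t₀))) : Base n × Base (n - 1)) =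
      mfderiv (𝓡 n).tangent 𝓘(ℝ, Base n × Base (n - 1))
        (ray : SlitTangent n M → _) (γ' t₀) (Γ'.field (γ' t₀)) := by
    have h6 : mfderiv (𝓡 n).tangent 𝓘(ℝ, Base n × Base (n - 1)) (ray : SlitTangent n M → _)
        (γ (r t₀)) (((1 : ℝ) • deriv r t₀) • Γ.field (γ (r t₀))) = _ := h4
    rw [map_smul, one_smul] at h6
    refine h6.trans ?_
    change mfderiv (𝓡 n).tangent 𝓘(ℝ, Base n × Base (n - 1)) (ray : SlitTangent n M → _)
        (γ' t₀) ((1 : ℝ) • Γ'.field (γ' t₀)) = _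
    rw [one_smul]
  -- `ray (γ' t₀)` and `ray (γ (r t₀))` are equal, but tangent vectors at them have different types.
  have key : ∀ s, s = ray (γ (r t₀)) → ∀ w : Base n × Base (n - 1),
      (mfderiv 𝓘(ℝ, Base n × Base (n - 1)) 𝓘(ℝ, ℝ × Base (2 * n - 2)) φ s w :
        ℝ × Base (2 * n - 2)).2 = 0 →
      (mfderiv 𝓘(ℝ, Base n × Base (n - 1)) 𝓘(ℝ, ℝ × Base (2 * n - 2)) φ (ray (γ (r t₀))) w :
        ℝ × Base (2 * n - 2)).2 = 0 := by
    rintro _ rfl w hw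
    exact hw
  have h6 := key _ hrp _ (hΓ' (γ' t₀) φ hφ (hrp ▸ hs))
  refine F.mem_distribution_of_chart _ hφ hs ?_
  rw [← h5] at h6
  have h7 := (congrArg Prod.snd (map_smul (mfderiv 𝓘(ℝ, Base n × Base (n - 1))
    𝓘(ℝ, ℝ × Base (2 * n - 2)) φ (ray (γ (r t₀)))) (deriv r t₀) _)).symm.trans h6
  exact (smul_eq_zero.1 h7).resolve_left (hr' t₀ ht₀).ne'

end Projective

end SprayDistribution

/-! ### The spray of a path geometry in coordinates -/

section Coordinates

lemma contDiffAt_clm_prod {E₁ E₂ E₃ E₄ : Type*} [NormedAddCommGroup E₁] [NormedSpace ℝ E₁]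
    [NormedAddCommGroup E₂] [NormedSpace ℝ E₂] [NormedAddCommGroup E₃] [NormedSpace ℝ E₃]
    [NormedAddCommGroup E₄] [NormedSpace ℝ E₄] {f : E₁ → E₂ →L[ℝ] E₃} {g : E₁ → E₂ →L[ℝ] E₄}
    {x : E₁} {m : ℕ∞ω} (hf : ContDiffAt ℝ m f x) (hg : ContDiffAt ℝ m g x) :
    ContDiffAt ℝ m (fun y => (f y).prod (g y)) x :=
  LinearIsometryEquiv.contDiff (ContinuousLinearMap.prodₗᵢ ℝ : (E₂ →L[ℝ] E₃) × (E₂ →L[ℝ] E₄) ≃ₗᵢ[ℝ]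
    E₂ →L[ℝ] E₃ × E₄) |>.contDiffAt.comp x (hf.prodMk hg)

variable {n : ℕ} {W : Type*} [NormedAddCommGroup W] [NormedSpace ℝ W]

/-- The linear map whose value determines the coordinates `w` of a tangent vector of `T°M` at the
point with coordinates `z = (x, v)`: the derivatives of `Φ` (a defining map of the distribution)
and of `N`, and the component along `v` of the projection to the base. -/
noncomputable def constraintMap (Φ : Base n × Base n → W) (N : Base n × Base n → ℝ)
    (z : Base n × Base n) : Base n × Base n →L[ℝ] W × ℝ × ℝ :=
  (fderiv ℝ Φ z).prod ((fderiv ℝ N z).prod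
    ((innerSL ℝ z.2).comp (ContinuousLinearMap.fst ℝ (Base n) (Base n))))

/-- The coordinate expression of the spray: the field annihilated by `dΦ` and `dN` whose projection
to the base has at `(x, v)` the same component along `v` as `v`. -/
noncomputable def coordSpray (Φ : Base n × Base n → W) (N : Base n × Base n → ℝ)
    (z : Base n × Base n) : Base n × Base n :=
  (constraintMap Φ N z).inverse (0, 0, ‖z.2‖ ^ 2)

variable {Φ : Base n × Base n → W} {N : Base n × Base n → ℝ} {z : Base n × Base n}

lemma eq_coordSpray_iff (h : (constraintMap Φ N z).IsInvertible) {w : Base n × Base n} :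
    w = coordSpray Φ N z ↔ constraintMap Φ N z w = (0, 0, ‖z.2‖ ^ 2) := by
  obtain ⟨e, he⟩ := h
  rw [coordSpray, ← he, ContinuousLinearMap.inverse_equiv, ContinuousLinearEquiv.coe_coe,
    ContinuousLinearEquiv.coe_coe, ContinuousLinearEquiv.eq_symm_apply]

lemma contDiffAt_coordSpray (hΦ : ContDiffAt ℝ ∞ Φ z) (hN : ContDiffAt ℝ ∞ N z)
    (h : (constraintMap Φ N z).IsInvertible) : ContDiffAt ℝ ∞ (coordSpray Φ N) z := by
  have h1 : ContDiffAt ℝ ∞ (constraintMap Φ N) z := by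
    have hin : ContDiffAt ℝ ∞ (fun z : Base n × Base n =>
        (innerSL ℝ z.2).comp (ContinuousLinearMap.fst ℝ (Base n) (Base n))) z :=
      ((innerSL ℝ).contDiff.comp contDiff_snd).contDiffAt.clm_comp contDiffAt_const
    exact contDiffAt_clm_prod (hΦ.fderiv_right (by simp))
      (contDiffAt_clm_prod (hN.fderiv_right (by simp)) hin)
  refine (h.contDiffAt_map_inverse.comp z h1).clm_apply ?_
  exact contDiffAt_const.prodMk (contDiffAt_const.prodMk
    ((contDiff_norm_sq ℝ).comp contDiff_snd).contDiffAt)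

/-- The coordinate expression `(x, v) ↦ (x, c v)` of the multiplication of vectors by `c`. -/
noncomputable def fibreScale (c : ℝ) : Base n × Base n →L[ℝ] Base n × Base n :=
  (ContinuousLinearMap.fst ℝ (Base n) (Base n)).prod
    (c • ContinuousLinearMap.snd ℝ (Base n) (Base n))

lemma fibreScale_apply (c : ℝ) (z : Base n × Base n) : fibreScale c z = (z.1, c • z.2) := rfl

/-- Homogeneity of the coordinate spray, from the invariance of the conditions that define it. -/
lemma coordSpray_fibreScale {c : ℝ} (hΦ : DifferentiableAt ℝ Φ (fibreScale c z))
    (hN : DifferentiableAt ℝ N (fibreScale c z)) (hΦc : Φ ∘ fibreScale c =ᶠ[𝓝 z] Φ)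
    (hNc : N ∘ fibreScale c =ᶠ[𝓝 z] c ^ 2 • N) (hNd : DifferentiableAt ℝ N z)
    (h : (constraintMap Φ N z).IsInvertible)
    (hc : (constraintMap Φ N (fibreScale c z)).IsInvertible) :
    coordSpray Φ N (fibreScale c z) = c • fibreScale c (coordSpray Φ N z) := by
  have h1 := (eq_coordSpray_iff h).1 rfl
  have hΦ' := (hΦ.hasFDerivAt.comp z (fibreScale c).hasFDerivAt).congr_of_eventuallyEq hΦc.symm
  have hN' := (hN.hasFDerivAt.comp z (fibreScale c).hasFDerivAt).congr_of_eventuallyEq hNc.symm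
  have hΦ2 := DFunLike.congr_fun hΦ'.fderiv (coordSpray Φ N z)
  have hN2 := DFunLike.congr_fun (hN'.unique (hNd.hasFDerivAt.const_smul (c ^ 2)))
    (coordSpray Φ N z)
  simp only [constraintMap, ContinuousLinearMap.prod_apply, Prod.mk.injEq,
    ContinuousLinearMap.comp_apply, ContinuousLinearMap.coe_fst', innerSL_apply_apply] at h1
  obtain ⟨h2, h3, h4⟩ := h1
  symm
  rw [eq_coordSpray_iff hc, map_smul]
  simp only [constraintMap, ContinuousLinearMap.prod_apply,
    ContinuousLinearMap.comp_apply, ContinuousLinearMap.coe_fst', innerSL_apply_apply]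
  refine Prod.ext ?_ (Prod.ext ?_ ?_)
  · exact (congrArg (c • ·) (hΦ2.symm.trans h2)).trans (smul_zero c)
  · refine (congrArg (c • ·) (hN2.trans (congrArg (c ^ 2 • ·) h3))).trans ?_
    simp
  · change c * inner ℝ (fibreScale c z).2 (fibreScale c (coordSpray Φ N z)).1 = _
    rw [fibreScale_apply, fibreScale_apply, inner_smul_left, h4, norm_smul, mul_pow,
      Real.norm_eq_abs, sq_abs]
    simp
    ring

/-- The coordinate expression `(x, v) ↦ (0, v)` of the Liouville field. -/
noncomputable def coordLiouville : Base n × Base n →L[ℝ] Base n × Base n :=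
  (0 : Base n × Base n →L[ℝ] Base n).prod (ContinuousLinearMap.snd ℝ (Base n) (Base n))

/-- The spray equation `[Δ, G] = G` for a field that is homogeneous of degree one at `z`, obtained
by differentiating the homogeneity relation with respect to `c` at `c = 1`. -/
lemma lieBracket_coordLiouville {G : Base n × Base n → Base n × Base n}
    (hG : DifferentiableAt ℝ G z)
    (h : ∀ c : ℝ, 0 < c → G (fibreScale c z) = c • fibreScale c (G z)) :
    VectorField.lieBracket ℝ coordLiouville G z = G z := by
  have hz : fibreScale 1 z = z := by simp [fibreScale_apply]
  have h1 : HasDerivAt (fun c : ℝ => fibreScale c z) (coordLiouville z) 1 := by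
    have := (hasDerivAt_const (1 : ℝ) z.1).prodMk ((hasDerivAt_id (1 : ℝ)).smul_const z.2)
    rwa [one_smul] at this
  have h2 : HasDerivAt (fun c : ℝ => G (fibreScale c z)) (fderiv ℝ G z (coordLiouville z)) 1 := by
    refine HasFDerivAt.comp_hasDerivAt (1 : ℝ) ?_ h1
    rw [hz]
    exact hG.hasFDerivAt
  have h3 : HasDerivAt (fun c : ℝ => c • fibreScale c (G z)) (G z + coordLiouville (G z)) 1 := by
    have h4 : HasDerivAt (fun c : ℝ => fibreScale c (G z)) (coordLiouville (G z)) 1 := by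
      have := (hasDerivAt_const (1 : ℝ) (G z).1).prodMk
        ((hasDerivAt_id (1 : ℝ)).smul_const (G z).2)
      rwa [one_smul] at this
    have h5 := (hasDerivAt_id (1 : ℝ)).smul h4
    have h6 : fibreScale 1 (G z) = G z := by simp [fibreScale_apply]
    rw [h6, id, one_smul, one_smul, add_comm] at h5
    exact h5
  have h4 := h2.unique (h3.congr_of_eventuallyEq
    (Filter.eventually_of_mem (Ioi_mem_nhds one_pos) fun c hc => h c hc))
  rw [VectorField.lieBracket, h4, ContinuousLinearMap.fderiv, add_sub_cancel_right]

end Coordinates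

/-! ### Existence of a spray tangent to the distribution -/

section Existence

variable {n : ℕ} {M : Type*} [TopologicalSpace M] [ChartedSpace (Base n) M]
  [IsManifold (𝓡 n) ∞ M]

lemma mlieBracket_eq_lieBracket {E : Type*} [NormedAddCommGroup E] [NormedSpace ℝ E]
    {V W : ∀ x : E, TangentSpace 𝓘(ℝ, E) x} :
    VectorField.mlieBracket 𝓘(ℝ, E) V W = VectorField.lieBracket ℝ V W := by
  rw [← VectorField.mlieBracketWithin_univ, VectorField.mlieBracketWithin_eq_lieBracketWithin]
  exact VectorField.lieBracketWithin_univ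

/-- The coordinates `(x, v)` are adapted to the projection to `M`: `v` is the derivative of the
chart of `M` applied to the tangent vector. -/
lemma coords_snd_eq_mfderiv (p : TangentBundle (𝓡 n) M) {q : SlitTangent n M}
    (hq : q.1 ∈ (tchart p).source) :
    (coords p q).2 = (mfderiv (𝓡 n) 𝓘(ℝ, Base n) (extChartAt (𝓡 n) p.1) (slitProj q) (slitVec q) :
      Base n) := by
  have hb : q.1.1 ∈ (chartAt (Base n) p.1).source := (TangentBundle.mem_chart_source_iff _ _).1 hq
  have h := TangentBundle.continuousLinearMapAt_trivializationAt (I := 𝓡 n) hb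
  have h2 : (trivializationAt (Base n) (TangentSpace (𝓡 n)) p.1).continuousLinearMapAt ℝ q.1.1
      q.1.2 = (coords p q).2 := by
    rw [Bundle.Trivialization.continuousLinearMapAt_apply, Bundle.Trivialization.linearMapAt_apply]
    exact if_pos hb
  rw [← h2]
  exact DFunLike.congr_fun h q.1.2

lemma mfderiv_coords_fst (p : TangentBundle (𝓡 n) M) {q : SlitTangent n M}
    (hq : q.1 ∈ (tchart p).source) (v : TangentSpace (𝓡 n).tangent q) :
    (mfderiv (𝓡 n).tangent 𝓘(ℝ, Base n × Base n) (coords p : SlitTangent n M → _) q v :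
      Base n × Base n).1 =
    (mfderiv (𝓡 n) 𝓘(ℝ, Base n) (extChartAt (𝓡 n) p.1) (slitProj q)
      (mfderiv (𝓡 n).tangent (𝓡 n) (slitProj : SlitTangent n M → M) q v) : Base n) := by
  have hb : q.1.1 ∈ (chartAt (Base n) p.1).source := (TangentBundle.mem_chart_source_iff _ _).1 hq
  have h1 := (mdifferentiableAt_extChartAt (I := 𝓡 n) hb).hasMFDerivAt.comp q
    (contMDiff_slitProj.mdifferentiable (by simp) q).hasMFDerivAt
  have h2 := (ContinuousLinearMap.fst ℝ (Base n) (Base n)).hasFDerivAt.hasMFDerivAt.comp q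
    (mdifferentiableAt_coords hq).hasMFDerivAt
  exact DFunLike.congr_fun (hasMFDerivAt_unique h2 h1) v

lemma mfderiv_coords_fst_eq_smul (p : TangentBundle (𝓡 n) M) {q : SlitTangent n M}
    (hq : q.1 ∈ (tchart p).source) {v : TangentSpace (𝓡 n).tangent q} {b : ℝ}
    (hv : (mfderiv (𝓡 n).tangent (𝓡 n) (slitProj : SlitTangent n M → M) q v : Base n) =
      b • (slitVec q : Base n)) :
    (mfderiv (𝓡 n).tangent 𝓘(ℝ, Base n × Base n) (coords p : SlitTangent n M → _) q v :
      Base n × Base n).1 = b • (coords p q).2 := by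
  rw [mfderiv_coords_fst p hq v, hv, coords_snd_eq_mfderiv p hq]
  exact map_smul (mfderiv (𝓡 n) 𝓘(ℝ, Base n) (extChartAt (𝓡 n) p.1) (slitProj q)) b (slitVec q)

lemma coords_snd_ne_zero {p : TangentBundle (𝓡 n) M} {q : SlitTangent n M}
    (hq : q.1 ∈ (tchart p).source) : (coords p q).2 ≠ 0 := fun h =>
  q.2 ((tchart_snd_eq_zero_iff p q.1 hq).1 h)

lemma eq_mpullback_coords_iff {p q : SlitTangent n M} (hq : q.1 ∈ (tchart p.1).source)
    (G : Base n × Base n → Base n × Base n) (v : TangentSpace (𝓡 n).tangent q) :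
    v = VectorField.mpullback (𝓡 n).tangent 𝓘(ℝ, Base n × Base n) (coords p.1) G q ↔
      (mfderiv (𝓡 n).tangent 𝓘(ℝ, Base n × Base n) (coords p.1 : SlitTangent n M → _) q v :
        Base n × Base n) = G (coords p.1 q) := by
  obtain ⟨e, he⟩ := isInvertible_mfderiv_coords hq
  let w : TangentSpace 𝓘(ℝ, Base n × Base n) (coords p.1 q) := G (coords p.1 q)
  change v = (mfderiv (𝓡 n).tangent 𝓘(ℝ, Base n × Base n)
    (coords p.1 : SlitTangent n M → _) q).inverse w ↔ mfderiv _ _ _ q v = w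
  rw [← he, ContinuousLinearMap.inverse_equiv]
  exact e.eq_symm_apply

/-- The conditions that single out the value at `p` of the spray of the path geometry `F` whose
integral curves preserve the function `N`. -/
structure PathGeometry.IsSprayVector (F : PathGeometry n M) (N : SlitTangent n M → ℝ)
    (p : SlitTangent n M) (v : TangentSpace (𝓡 n).tangent p) : Prop where
  mem_distribution : v ∈ F.distribution p
  slitProj_eq : mfderiv (𝓡 n).tangent (𝓡 n) (slitProj : SlitTangent n M → M) p v = slitVec p
  map_eq_zero : mfderiv (𝓡 n).tangent 𝓘(ℝ, ℝ) N p v = 0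

section Local

variable (F : PathGeometry n M) {N : SlitTangent n M → ℝ}
  {φ : OpenPartialHomeomorph (SphereBundle n M) (ℝ × Base (2 * n - 2))}

/-- A function on `T°M`, read in the coordinates around `p`. -/
noncomputable def inCoords {W : Type*} (p : SlitTangent n M) (f : SlitTangent n M → W) :
    Base n × Base n → W := f ∘ (extChartAt (𝓡 n).tangent p).symm

lemma inCoords_coords {W : Type*} (p : SlitTangent n M) (f : SlitTangent n M → W)
    {q : SlitTangent n M} (hq : q.1 ∈ (tchart p.1).source) :
    inCoords p f (coords p.1 q) = f q :=
  congrArg f ((extChartAt (𝓡 n).tangent p).left_inv ((mem_extChartAt_slit_source p q).2 hq))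

lemma contDiffAt_inCoords {W : Type*} [NormedAddCommGroup W] [NormedSpace ℝ W]
    (p : SlitTangent n M) {f : SlitTangent n M → W} {q : SlitTangent n M}
    (hq : q.1 ∈ (tchart p.1).source)
    (hf : ContMDiffAt (𝓡 n).tangent 𝓘(ℝ, W) ∞ f q) :
    ContDiffAt ℝ ∞ (inCoords p f) (coords p.1 q) := by
  have hs := (mem_extChartAt_slit_source p q).2 hq
  have hsym : ContMDiffAt 𝓘(ℝ, Base n × Base n) (𝓡 n).tangent ∞
      (extChartAt (𝓡 n).tangent p).symm (coords p.1 q) :=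
    (contMDiffOn_extChartAt_symm (n := ∞) p).contMDiffAt
      ((isOpen_extChartAt_target p).mem_nhds ((extChartAt (𝓡 n).tangent p).map_source hs))
  have hl : (extChartAt (𝓡 n).tangent p).symm (coords p.1 q) = q :=
    (extChartAt (𝓡 n).tangent p).left_inv hs
  rw [← hl] at hf
  exact (hf.comp (coords p.1 q) hsym).contDiffAt

lemma fderiv_inCoords {W : Type*} [NormedAddCommGroup W] [NormedSpace ℝ W]
    (p : SlitTangent n M) {f : SlitTangent n M → W} {q : SlitTangent n M}
    (hq : q.1 ∈ (tchart p.1).source)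
    (hf : ContMDiffAt (𝓡 n).tangent 𝓘(ℝ, W) ∞ f q) (v : TangentSpace (𝓡 n).tangent q) :
    fderiv ℝ (inCoords p f) (coords p.1 q)
      (mfderiv (𝓡 n).tangent 𝓘(ℝ, Base n × Base n) (coords p.1 : SlitTangent n M → _) q v) =
      (mfderiv (𝓡 n).tangent 𝓘(ℝ, W) f q v : W) := by
  have h1 := ((contDiffAt_inCoords p hq hf).differentiableAt (by simp)).hasFDerivAt.hasMFDerivAt
    |>.comp q (mdifferentiableAt_coords hq).hasMFDerivAt
  have h2 := h1.congr_of_eventuallyEq (f₁ := f)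
    (Filter.eventually_of_mem (tchart_source_mem_nhds hq) fun r hr => (inCoords_coords p f hr).symm)
  exact DFunLike.congr_fun
    (hasMFDerivAt_unique h2 (hf.mdifferentiableAt (by simp)).hasMFDerivAt) v

lemma inCoords_comp_fibreScale {W : Type*} (p : SlitTangent n M) {f g : SlitTangent n M → W}
    {q : SlitTangent n M} (hq : q.1 ∈ (tchart p.1).source) {c : ℝ} (hc : 0 < c)
    (hf : ∀ r, f (scale c hc r) = g r) :
    inCoords p f ∘ fibreScale c =ᶠ[𝓝 (coords p.1 q)] inCoords p g := by
  have hs := (mem_extChartAt_slit_source p q).2 hq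
  filter_upwards [(isOpen_extChartAt_target p).mem_nhds
    ((extChartAt (𝓡 n).tangent p).map_source hs)] with z hz
  have hr := (mem_extChartAt_slit_source p _).1 ((extChartAt (𝓡 n).tangent p).map_target hz)
  have hz' : coords p.1 ((extChartAt (𝓡 n).tangent p).symm z) = z :=
    (extChartAt (𝓡 n).tangent p).right_inv hz
  rw [← hz', Function.comp_apply, fibreScale_apply, ← coords_scale p.1 c hc,
    inCoords_coords p f ((scale_mem_tchart_source c hc).2 hr), inCoords_coords p g hr, hf]

lemma contMDiffAt_chart_ray (hφ : φ ∈ F.charts) {q : SlitTangent n M} (hs : ray q ∈ φ.source) :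
    ContMDiffAt (𝓡 n).tangent 𝓘(ℝ, Base (2 * n - 2)) ∞ (fun r => (φ (ray r)).2) q :=
  (contDiff_snd.contMDiff (n := ∞)).contMDiffAt.comp q
    (((F.smooth φ hφ).contMDiffAt (φ.open_source.mem_nhds hs)).comp q (contMDiff_ray q))

lemma mfderiv_chart_ray (hφ : φ ∈ F.charts) {q : SlitTangent n M} (hs : ray q ∈ φ.source)
    (v : TangentSpace (𝓡 n).tangent q) :
    (mfderiv (𝓡 n).tangent 𝓘(ℝ, Base (2 * n - 2)) (fun r => (φ (ray r)).2) q v :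
      Base (2 * n - 2)) =
    (mfderiv 𝓘(ℝ, Base n × Base (n - 1)) 𝓘(ℝ, ℝ × Base (2 * n - 2)) φ (ray q)
      (mfderiv (𝓡 n).tangent 𝓘(ℝ, Base n × Base (n - 1)) (ray : SlitTangent n M → _) q v) :
        ℝ × Base (2 * n - 2)).2 := by
  have h1 := ((F.mdifferentiable hφ).mdifferentiableAt hs).hasMFDerivAt.comp q
    (contMDiff_ray.mdifferentiable (by simp) q).hasMFDerivAt
  have h2 := (ContinuousLinearMap.snd ℝ ℝ (Base (2 * n - 2))).hasFDerivAt.hasMFDerivAt.comp q h1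
  exact DFunLike.congr_fun (hasMFDerivAt_unique
    ((contMDiffAt_chart_ray F hφ hs).mdifferentiableAt (by simp)).hasMFDerivAt h2) v

/-- `constraintMap`, applied to the coordinates of `v`, in terms of the manifolds `T°M` and `STM`. -/
lemma constraintMap_mfderiv_coords (hφ : φ ∈ F.charts)
    (hN : ContMDiff (𝓡 n).tangent 𝓘(ℝ, ℝ) ∞ N) {p q : SlitTangent n M}
    (hq : q.1 ∈ (tchart p.1).source) (hs : ray q ∈ φ.source) (v : TangentSpace (𝓡 n).tangent q) :
    constraintMap (inCoords p fun r => (φ (ray r)).2) (inCoords p N) (coords p.1 q)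
      (mfderiv (𝓡 n).tangent 𝓘(ℝ, Base n × Base n) (coords p.1 : SlitTangent n M → _) q v) =
    ((mfderiv 𝓘(ℝ, Base n × Base (n - 1)) 𝓘(ℝ, ℝ × Base (2 * n - 2)) φ (ray q)
        (mfderiv (𝓡 n).tangent 𝓘(ℝ, Base n × Base (n - 1)) (ray : SlitTangent n M → _) q v) :
          ℝ × Base (2 * n - 2)).2,
      (mfderiv (𝓡 n).tangent 𝓘(ℝ, ℝ) N q v : ℝ),
      inner ℝ (coords p.1 q).2 (mfderiv (𝓡 n).tangent 𝓘(ℝ, Base n × Base n)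
        (coords p.1 : SlitTangent n M → _) q v : Base n × Base n).1) := by
  refine Prod.ext ?_ (Prod.ext ?_ rfl)
  · exact (fderiv_inCoords p hq (contMDiffAt_chart_ray F hφ hs) v).trans
      (mfderiv_chart_ray F hφ hs v)
  · exact fderiv_inCoords p hq (hN q) v

/-- Injectivity is the uniqueness of the spray vector: a vector in the kernel is tangent to the
distribution and projects to zero, hence is a multiple of `Δ`, and it is killed by `dN` while
`dN Δ = 2 N > 0`. Invertibility follows by counting dimensions. -/
lemma isInvertible_constraintMap (hn : 1 ≤ n) (hφ : φ ∈ F.charts)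
    (hN : ContMDiff (𝓡 n).tangent 𝓘(ℝ, ℝ) ∞ N) (hpos : ∀ p, 0 < N p)
    (hhom : ∀ (c : ℝ) (hc : 0 < c) (p : SlitTangent n M), N (scale c hc p) = c ^ 2 * N p)
    {p q : SlitTangent n M} (hq : q.1 ∈ (tchart p.1).source) (hs : ray q ∈ φ.source) :
    (constraintMap (inCoords p fun r => (φ (ray r)).2) (inCoords p N)
      (coords p.1 q)).IsInvertible := by
  set L := constraintMap (inCoords p fun r => (φ (ray r)).2) (inCoords p N) (coords p.1 q)
  have hinj : Function.Injective L.toLinearMap := by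
    rw [injective_iff_map_eq_zero]
    intro w hw
    obtain ⟨v, rfl⟩ := (isInvertible_mfderiv_coords hq).surjective w
    have h1 := (constraintMap_mfderiv_coords F hφ hN hq hs v).symm.trans hw
    have hv := F.mem_distribution_of_chart q hφ hs (congrArg Prod.fst h1)
    obtain ⟨b, hb, hb0⟩ := F.exists_mfderiv_slitProj_eq_smul q hv
    have h2 := congrArg (fun x => x.2.2) h1
    have h3 := congrArg (fun x => x.2.1) h1
    have hy := real_inner_self_pos.2 (coords_snd_ne_zero hq)
    simp only [mfderiv_coords_fst_eq_smul p.1 hq hb, inner_smul_right] at h2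
    obtain ⟨a, ha⟩ := hb0 ((mul_eq_zero.1 h2).resolve_right hy.ne')
    have h5 : a * (2 * N q) = 0 := by
      have h6 := mfderiv_liouville_of_homogeneous (hN.mdifferentiable (by simp) q)
        fun c hc => hhom c hc q
      rw [ha] at h3
      exact (congrArg (a * ·) h6).symm.trans
        ((map_smul (mfderiv (𝓡 n).tangent 𝓘(ℝ, ℝ) N q) a (liouville q)).symm.trans h3)
    have h7 : a = 0 := (mul_eq_zero.1 h5).resolve_right (mul_pos two_pos (hpos q)).ne'
    rw [ha, h7, zero_smul]
    exact map_zero _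
  -- The truncated subtraction in `2 * n - 2` is harmless for `1 ≤ n`.
  have hdim : Module.finrank ℝ (Base n × Base n) =
      Module.finrank ℝ (Base (2 * n - 2) × ℝ × ℝ) := by
    simp only [Module.finrank_prod, finrank_euclideanSpace_fin, Module.finrank_self]
    omega
  exact ⟨(LinearEquiv.ofInjectiveOfFinrankEq L.toLinearMap hinj hdim).toContinuousLinearEquiv,
    ContinuousLinearMap.ext fun _ => rfl⟩

/-- In the coordinates of a foliated chart the spray vectors form a smooth field that satisfies the
spray equation. -/
lemma exists_local_spray (hn : 1 ≤ n) (hφ : φ ∈ F.charts)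
    (hN : ContMDiff (𝓡 n).tangent 𝓘(ℝ, ℝ) ∞ N) (hpos : ∀ p, 0 < N p)
    (hhom : ∀ (c : ℝ) (hc : 0 < c) (p : SlitTangent n M), N (scale c hc p) = c ^ 2 * N p)
    (p : SlitTangent n M) (hs : ray p ∈ φ.source) :
    ∃ G : Base n × Base n → Base n × Base n, ContDiffAt ℝ ∞ G (coords p.1 p) ∧
      VectorField.lieBracket ℝ coordLiouville G (coords p.1 p) = G (coords p.1 p) ∧
      ∀ᶠ q in 𝓝 p, ∀ v : TangentSpace (𝓡 n).tangent q, F.IsSprayVector N q v ↔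
        mfderiv (𝓡 n).tangent 𝓘(ℝ, Base n × Base n) (coords p.1 : SlitTangent n M → _) q v =
          G (coords p.1 q) := by
  have hp : p.1 ∈ (tchart p.1).source := mem_chart_source _ p.1
  have hinv := fun (q : SlitTangent n M) (hq : q.1 ∈ (tchart p.1).source) =>
    isInvertible_constraintMap F hn hφ hN hpos hhom (p := p) hq
  have hΦ := fun (q : SlitTangent n M) (hq : q.1 ∈ (tchart p.1).source) (h : ray q ∈ φ.source) =>
    contDiffAt_inCoords p hq (contMDiffAt_chart_ray F hφ h)
  have hN' := fun (q : SlitTangent n M) (hq : q.1 ∈ (tchart p.1).source) =>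
    contDiffAt_inCoords p hq (hN q)
  have hG := contDiffAt_coordSpray (hΦ p hp hs) (hN' p hp) (hinv p hp hs)
  refine ⟨coordSpray (inCoords p fun r => (φ (ray r)).2) (inCoords p N), hG,
    lieBracket_coordLiouville (hG.differentiableAt (by simp)) fun c hc => ?_, ?_⟩
  · have hsc : fibreScale c (coords p.1 p) = coords p.1 (scale c hc p) :=
      (coords_scale p.1 c hc p).symm
    have hpc := (scale_mem_tchart_source (p := p.1) c hc).2 hp
    have hsc' : ray (scale c hc p) ∈ φ.source := by rwa [ray_scale]
    refine coordSpray_fibreScale ?_ ?_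
      (inCoords_comp_fibreScale p hp hc fun r => by rw [ray_scale])
      (inCoords_comp_fibreScale p hp hc fun r => hhom c hc r)
      ((hN' p hp).differentiableAt (by simp)) (hinv p hp hs) ?_
    · rw [hsc]
      exact (hΦ _ hpc hsc').differentiableAt (by simp)
    · rw [hsc]
      exact (hN' _ hpc).differentiableAt (by simp)
    · rw [hsc]
      exact hinv _ hpc hsc'
  · filter_upwards [tchart_source_mem_nhds hp,
      (φ.open_source.preimage isOpenQuotientMap_ray.continuous).mem_nhds hs] with q hq hqs v
    have hy := real_inner_self_pos.2 (coords_snd_ne_zero hq)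
    refine Iff.trans ?_ (eq_coordSpray_iff (hinv q hq hqs)).symm
    rw [constraintMap_mfderiv_coords F hφ hN hq hqs v]
    constructor
    · rintro ⟨h1, h2, h3⟩
      refine Prod.ext (h1 φ hφ hqs) (Prod.ext h3 ?_)
      have h4 := mfderiv_coords_fst_eq_smul p.1 hq (v := v) (b := 1)
        (h2.trans (one_smul ℝ (slitVec q : Base n)).symm)
      change inner ℝ (coords p.1 q).2 _ = _
      rw [h4, one_smul, real_inner_self_eq_norm_sq]
    · intro h
      have h1 := F.mem_distribution_of_chart q hφ hqs (congrArg Prod.fst h)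
      obtain ⟨b, hb, -⟩ := F.exists_mfderiv_slitProj_eq_smul q h1
      refine ⟨h1, ?_, congrArg (fun x => x.2.1) h⟩
      have h2 := congrArg (fun x => x.2.2) h
      simp only [mfderiv_coords_fst_eq_smul p.1 hq hb, inner_smul_right,
        ← real_inner_self_eq_norm_sq] at h2
      have hb1 : b = 1 := mul_right_cancel₀ hy.ne' (h2.trans (one_mul _).symm)
      rw [hb1, one_smul] at hb
      exact hb

end Local

open VectorField in
/-- Every path geometry is tangent to a spray, namely the one that preserves a chosen homogeneous
function. -/
lemma PathGeometry.exists_spray_mem_distribution (hn : 1 ≤ n) [T2Space M] [ParacompactSpace M]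
    (F : PathGeometry n M) : ∃ Γ : Spray n M, ∀ p, Γ.field p ∈ F.distribution p := by
  obtain ⟨N, hN, hpos, hhom⟩ := exists_homogeneous_contMDiff_pos (n := n) (M := M)
  have hloc : ∀ p : SlitTangent n M, ∃ G : Base n × Base n → Base n × Base n,
      ContDiffAt ℝ ∞ G (coords p.1 p) ∧
      lieBracket ℝ coordLiouville G (coords p.1 p) = G (coords p.1 p) ∧
      ∀ᶠ q in 𝓝 p, ∀ v : TangentSpace (𝓡 n).tangent q, F.IsSprayVector N q v ↔
        v = mpullback (𝓡 n).tangent 𝓘(ℝ, Base n × Base n) (coords p.1) G q := by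
    intro p
    obtain ⟨φ, hφ, hs⟩ := F.cover (ray p)
    obtain ⟨G, hG, hGb, hGv⟩ := exists_local_spray F hn hφ hN hpos hhom p hs
    refine ⟨G, hG, hGb, ?_⟩
    filter_upwards [hGv, tchart_source_mem_nhds (q := p) (mem_chart_source _ p.1)] with q hq hqs v
    exact (hq v).trans (eq_mpullback_coords_iff hqs G v).symm
  have hex : ∀ p : SlitTangent n M, ∃ v, F.IsSprayVector N p v := fun p => by
    obtain ⟨G, -, -, hG⟩ := hloc p
    exact ⟨_, (hG.self_of_nhds _).2 rfl⟩
  -- The spray vector is unique by `hloc`, so the chosen values form a smooth field.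
  choose Γ hΓ using hex
  have hcoords : ∀ p : SlitTangent n M, ContMDiffAt (𝓡 n).tangent 𝓘(ℝ, Base n × Base n) ∞
      (coords p.1 : SlitTangent n M → _) p := fun p =>
    contMDiffAt_coords (mem_chart_source _ p.1)
  have hinv : ∀ p : SlitTangent n M, (mfderiv (𝓡 n).tangent 𝓘(ℝ, Base n × Base n)
      (coords p.1 : SlitTangent n M → _) p).IsInvertible := fun p =>
    isInvertible_mfderiv_coords (mem_chart_source _ p.1)
  refine ⟨⟨Γ, fun p => ?_, fun p => (hΓ p).slitProj_eq, fun p => ?_⟩,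
    fun p => (hΓ p).mem_distribution⟩
  · obtain ⟨G, hG, -, hGv⟩ := hloc p
    have h1 := ContMDiffAt.mpullback_vectorField_preimage (m := ∞)
      (contMDiffAt_vectorSpace_iff_contDiffAt.2 hG) (hcoords p) (hinv p) (by simp)
    refine h1.congr_of_eventuallyEq ?_
    filter_upwards [hGv] with q hq
    rw [(hq _).1 (hΓ q)]
  · obtain ⟨G, hG, hGb, hGv⟩ := hloc p
    have hΓG : Γ =ᶠ[𝓝 p] mpullback (𝓡 n).tangent 𝓘(ℝ, Base n × Base n) (coords p.1) G := by
      filter_upwards [hGv] with q hq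
      exact (hq _).1 (hΓ q)
    have hΔ : liouville =ᶠ[𝓝 p]
        mpullback (𝓡 n).tangent 𝓘(ℝ, Base n × Base n) (coords p.1)
          (fun z => coordLiouville z) := by
      filter_upwards [tchart_source_mem_nhds (q := p) (mem_chart_source _ p.1)] with q hq
      exact (eq_mpullback_coords_iff hq (fun z => coordLiouville z) _).2
        (mfderiv_coords_liouville hq)
    have : IsManifold (𝓡 n).tangent (minSmoothness ℝ 2) (SlitTangent n M) := by
      rw [minSmoothness_of_isRCLikeNormedField]
      infer_instance
    have h2 : minSmoothness ℝ 2 ≤ ∞ := by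
      rw [minSmoothness_of_isRCLikeNormedField]
      exact WithTop.coe_le_coe.2 le_top
    rw [hΔ.mlieBracket_vectorField_eq hΓG, ← mpullback_mlieBracket
      (contMDiffAt_vectorSpace_iff_contDiffAt.2
        coordLiouville.contDiff.contDiffAt |>.mdifferentiableAt (n := ∞) (by simp))
      (contMDiffAt_vectorSpace_iff_contDiffAt.2 hG |>.mdifferentiableAt (by simp))
      (hcoords p) h2, hΓG.self_of_nhds]
    refine congrArg (mfderiv (𝓡 n).tangent 𝓘(ℝ, Base n × Base n)
      (coords p.1 : SlitTangent n M → _) p).inverse ?_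
    exact (congrFun mlieBracket_eq_lieBracket (coords p.1 p)).trans hGb

end Existence

end PathGeom

theorem theorem1 {n : ℕ} (hn : 3 ≤ n) {M : Type*} [TopologicalSpace M] [T2Space M]
    [ParacompactSpace M] [ChartedSpace (EuclideanSpace ℝ (Fin n)) M] [IsManifold (𝓡 n) ∞ M]
    (F : PathGeometry n M) :
    ∃ C : ProjectiveClass n M, ∀ Γ : Spray n M, Γ ∈ C → ∀ p : SlitTangent n M,
      F.distribution p = Submodule.span ℝ {liouville p, Γ.field p} := by
  obtain ⟨Γ₀, hΓ₀⟩ := F.exists_spray_mem_distribution (by omega)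
  refine ⟨Quotient.mk (projSetoid n M) Γ₀, fun Γ hΓ p => ?_⟩
  have h : Γ.ReparamTo Γ₀ ∧ Γ₀.ReparamTo Γ := Quotient.exact hΓ
  exact F.distribution_eq_span p (F.field_mem_distribution_of_reparamTo h.1 hΓ₀ p)
    (Γ.second_order p)
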